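/- Let $d\ge 2$ be an integer, let $0<s<1$, $p>1$, $q\ge 1$, $\tau\ge 1$, $0<a\le 1$, $\Lambda>1$ and $\alpha,\beta,\gamma\in\mathbb{R}$ be real numbers, and define $\sigma\in\mathbb{R}$ by $\gamma=a\sigma+(1-a)\beta$. For a measurable function $g$ on $\mathbb{R}^d$ put $$\|g\|_{\dot W^{s,p,\alpha,\Lambda}(\mathbb{R}^d)}=\left(\int_{\mathbb{R}^d}\int_{\mathbb{R}^d}\frac{|g(x)-g(y)|^p\,|x|^{\alpha p}}{|x-y|^{d+sp}}\,\chi_\Lambda(|x|,|y|)\,dx\,dy\right)^{1/p}\in[0,\infty],$$ where $\chi_\Lambda(r_1,r_2)=1$ if $\Lambda^{-1}r_1\le r_2\le\Lambda r_1$ and $\chi_\Lambda(r_1,r_2)=0$ otherwise. Assume the balance law $$\frac1\tau+\frac\gamma d=a\left(\frac1p+\frac{\alpha-s}{d}\right)+(1-a)\left(\frac1q+\frac\beta d\right)$$ and $$-(d-1)s\le\alpha-\sigma<0.$$ Then there is a constant $C>0$, depending only on $d,s,p,q,\tau,a,\alpha,\beta,\gamma,\Lambda$, such that the following hold. (i)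 If $\frac1\tau+\frac\gamma d>0$, then for every radial $u\in L^1_{\mathrm{loc}}(\mathbb{R}^d\setminus\{0\})$ with compact support in $\mathbb{R}^d$, $$\big\||x|^\gamma u\big\|_{L^\tau(\mathbb{R}^d)}\le C\,\|u\|_{\dot W^{s,p,\alpha,\Lambda}(\mathbb{R}^d)}^{a}\,\big\||x|^\beta u\big\|_{L^q(\mathbb{R}^d)}^{1-a}.\qquad(*)$$ (ii) If $\frac1\tau+\frac\gamma d<0$, then $(*)$ holds for every radial $u\in L^1_{\mathrm{loc}}(\mathbb{R}^d\setminus\{0\})$ which is $0$ in a neighborhood of $0$. Here all norms take values in $[0,\infty]$, with the conventions $(+\infty)\cdot 0=0\cdot(+\infty)=0$, $t^0=1$ for every $t\in[0,\infty]$ (this is the case $a=1$), and $+\infty\le+\infty$. -/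

import Mathlib

open MeasureTheory

noncomputable section

/-- The cut-off `χ_Λ(r₁, r₂)`, equal to `1` if `Λ⁻¹ r₁ ≤ r₂ ≤ Λ r₁` and to `0` otherwise. -/
def chiCut (Λ r₁ r₂ : ℝ) : ℝ :=
  if Λ⁻¹ * r₁ ≤ r₂ ∧ r₂ ≤ Λ * r₁ then 1 else 0

/-- The weighted fractional seminorm of `g` on `ℝ^d`,
`(∫∫ |g x - g y|^p |x|^(α p) |x - y|^(-(d + s p)) χ_Λ(|x|, |y|) dx dy)^(1/p)`,
with values in `[0, ∞]`. -/
def fracSeminorm {d : ℕ} (s p α Λ : ℝ) (g : EuclideanSpace ℝ (Fin d) → ℝ) : ENNReal :=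
  (∫⁻ y : EuclideanSpace ℝ (Fin d), ∫⁻ x : EuclideanSpace ℝ (Fin d),
    ENNReal.ofReal
      (|g x - g y| ^ p * ‖x‖ ^ (α * p) / ‖x - y‖ ^ ((d : ℝ) + s * p) * chiCut Λ ‖x‖ ‖y‖)) ^ (1 / p)

/-- The weighted norm `‖ |x|^γ u ‖_{L^τ(ℝ^d)}`, with values in `[0, ∞]`. -/
def weightedNorm {d : ℕ} (γ τ : ℝ) (u : EuclideanSpace ℝ (Fin d) → ℝ) : ENNReal :=
  eLpNorm (fun x => ‖x‖ ^ γ * u x) (ENNReal.ofReal τ) volume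

/-- `u` is radial: it agrees almost everywhere with a function of `|x|`. -/
def IsRadial {d : ℕ} (u : EuclideanSpace ℝ (Fin d) → ℝ) : Prop :=
  ∃ f : ℝ → ℝ, ∀ᵐ x : EuclideanSpace ℝ (Fin d), u x = f ‖x‖

/-- The (essential) support of `u` is compact: `u` vanishes almost everywhere off a compact set. -/
def HasCompactEssSupport {d : ℕ} (u : EuclideanSpace ℝ (Fin d) → ℝ) : Prop :=
  ∃ K : Set (EuclideanSpace ℝ (Fin d)), IsCompact K ∧
    ∀ᵐ x : EuclideanSpace ℝ (Fin d), x ∉ K → u x = 0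

/-- `u` vanishes (almost everywhere) in a neighbourhood of the origin. -/
def VanishesNearZero {d : ℕ} (u : EuclideanSpace ℝ (Fin d) → ℝ) : Prop :=
  ∃ r : ℝ, 0 < r ∧ ∀ᵐ x : EuclideanSpace ℝ (Fin d), ‖x‖ < r → u x = 0

end

open Metric Set
open scoped ENNReal

-- Let `P` be the τ-th power of the left-hand side and write u(x) = f(|x|). The value f(|x|) is
-- compared with averages of f at two scales. Over a ball of radius r ≤ c|x|, Jensen's inequality
-- bounds the oscillation by r^s |x|^(-α) `fracDensity`^(1/p). Since f is radial, the ball carries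
-- at most a fraction of order (r/|x|)^(d-1) of the integral over the surrounding annulus, so the
-- average costs only r^(-1/τ), as in dimension one (`abs_le_ball_bound`). Over a dilated annulus
-- |x|A, the average of |f|^τ enters with constant exactly 1 (`abs_le_dilation_bound`).
--
-- Optimizing in r, and falling back on the second bound when the optimal r is too large, gives |f|
-- ≤ (dilation average)^(1/τ) + C F^θ M^(1-θ), where F contains the seminorm density and M contains
-- `P`. After raising to the power τ, weighting and integrating, the dilation term is at most kP
-- with k < 1: averaging over dilations is a strict contraction in the weighted norm when A lies on
-- the correct side of the unit sphere, which is possible because γτ + d ≠ 0. Hölder's inequality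
-- turns the other term into a product of the seminorm, the `β`-norm and P^e with e < 1. If P is
-- finite, kP is absorbed (`radial_interpolation_of_ne_top`).
--
-- Finiteness is arranged by truncating f: a bounded f has finite P when it has compact support and
-- γτ + d > 0, or when it vanishes near 0 and γτ + d < 0. Truncation does not increase the
-- right-hand side, and Fatou's lemma removes it.

local notation "𝔼" d => EuclideanSpace ℝ (Fin d)

/-! ### Averages of radial functions over balls and over dilations -/

/-- Jensen's inequality for powers on a probability space. -/
theorem lintegral_le_rpow_lintegral_rpow {X : Type*} [MeasurableSpace X] (ν : Measure X)
    [IsProbabilityMeasure ν] {f : X → ℝ≥0∞} (hf : AEMeasurable f ν) {p : ℝ} (hp : 1 ≤ p) :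
    ∫⁻ x, f x ∂ν ≤ (∫⁻ x, f x ^ p ∂ν) ^ (1 / p) := by
  have hp0 : 0 < p := by linarith
  have h := ENNReal.lintegral_mul_norm_pow_le (μ := ν) (f := fun x => f x ^ p) (g := fun _ => 1)
    (hf.pow_const p) aemeasurable_const (p := 1 / p) (q := 1 - 1 / p) (by positivity)
    (by rw [sub_nonneg, div_le_one hp0]; exact hp) (by ring)
  simpa [← ENNReal.rpow_mul, hp0.ne'] using h

/-- Change of variables for a dilation. -/
theorem lintegral_comp_pos_smul {d : ℕ} {w : ℝ} (hw : 0 < w) {g : (𝔼 d) → ℝ≥0∞}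
    (hg : Measurable g) :
    ∫⁻ x, g (w • x) = ENNReal.ofReal (w ^ d)⁻¹ * ∫⁻ x, g x := by
  have h := lintegral_map (μ := volume) hg (measurable_const_smul (α := 𝔼 d) w)
  have h2 : (w • · : (𝔼 d) → 𝔼 d) = fun x => w • x := rfl
  rw [← h, h2, Measure.map_addHaar_smul _ hw.ne', lintegral_smul_measure,
    abs_of_nonneg (by positivity), finrank_euclideanSpace_fin]
  rfl

theorem volume_ball_pos_radius {d : ℕ} (x : 𝔼 d) {r : ℝ} (hr : 0 < r) :
    volume (ball x r) = ENNReal.ofReal (r ^ d) * volume (ball (0 : 𝔼 d) 1) := by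
  rw [Measure.addHaar_ball_of_pos _ _ hr, finrank_euclideanSpace_fin]

/-- The integral of a radial function over a ball depends only on the norm of the centre. -/
theorem setLIntegral_ball_eq_of_norm_eq {d : ℕ} (φ : ℝ → ℝ≥0∞) {x y : 𝔼 d} (h : ‖x‖ = ‖y‖)
    (r : ℝ) : ∫⁻ z in ball x r, φ ‖z‖ = ∫⁻ z in ball y r, φ ‖z‖ := by
  -- The reflection in the hyperplane bisecting x and y is a volume-preserving isometry fixing 0,
  -- and it takes one ball to the other.
  set L := (Submodule.span ℝ {x - y})ᗮ.reflection with hL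
  have hxy : L x = y := Submodule.reflection_sub h
  have hmp : MeasurePreserving L volume volume := L.measurePreserving
  have h1 := hmp.setLIntegral_comp_preimage_emb L.toHomeomorph.measurableEmbedding
    (fun z => φ ‖z‖) (ball y r)
  have h2 : L ⁻¹' ball y r = ball x r := by
    rw [← hxy]; simp
  simpa [h2] using h1

/-- Every centre in a shell of thickness r outside the sphere through x sees, in its ball of radius
2r, at least the integral over `ball x r`. Integrating over these centres and exchanging integrals
counts each y at most |B(2r)| times, while the shell has volume at least of order r |x|^(d-1). The
quotient is the factor (r/|x|)^(d-1), which is the gain from radial symmetry. -/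
theorem lintegral_ball_le_annulus {d : ℕ} (hd : 1 ≤ d) {φ : ℝ → ℝ≥0∞} (hφ : Measurable φ)
    {x : 𝔼 d} {r : ℝ} (hr : 0 < r) (hrx : 6 * r ≤ ‖x‖) :
    ∫⁻ y in ball x r, φ ‖y‖ ≤ ENNReal.ofReal (2 ^ d * (r / ‖x‖) ^ (d - 1)) *
      ∫⁻ y in {y : 𝔼 d | ‖x‖ / 2 ≤ ‖y‖ ∧ ‖y‖ ≤ 2 * ‖x‖}, φ ‖y‖ := by
  set R := ‖x‖ with hR
  have hR0 : 0 < R := by linarith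
  have : Nontrivial (𝔼 d) := ⟨x, 0, by rw [← norm_pos_iff]; exact hR0⟩
  set ω := volume (ball (0 : 𝔼 d) 1) with hω
  have hω0 : ω ≠ 0 := (measure_ball_pos _ _ one_pos).ne'
  have hωt : ω ≠ ∞ := measure_ball_lt_top.ne
  set T : Set (𝔼 d) := {y | R / 2 ≤ ‖y‖ ∧ ‖y‖ ≤ 2 * R} with hT
  have hTm : MeasurableSet T :=
    (measurableSet_le measurable_const measurable_norm).inter
      (measurableSet_le measurable_norm measurable_const)
  set Sh : Set (𝔼 d) := ball 0 (R + r) \ ball 0 R with hSh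
  have hShm : MeasurableSet Sh := measurableSet_ball.diff measurableSet_ball
  have hvol : ENNReal.ofReal (r * R ^ (d - 1)) * ω ≤ volume Sh := by
    rw [hSh, measure_sdiff (ball_subset_ball (by linarith)) measurableSet_ball.nullMeasurableSet
      measure_ball_lt_top.ne, volume_ball_pos_radius _ (by positivity),
      volume_ball_pos_radius _ hR0, ← ENNReal.sub_mul (fun _ _ => hωt),
      ← ENNReal.ofReal_sub _ (by positivity)]
    gcongr
    obtain ⟨n, rfl⟩ : ∃ n, d = n + 1 := ⟨d - 1, by omega⟩
    have : R ^ n ≤ (R + r) ^ n := pow_le_pow_left₀ hR0.le (by linarith) _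
    simp only [Nat.add_sub_cancel, pow_succ]
    nlinarith
  have hcomp : ∀ x' ∈ Sh, ∫⁻ y in ball x r, φ ‖y‖ ≤ ∫⁻ y in ball x' (2 * r), φ ‖y‖ := by
    intro x' hx'
    have h1 : ‖x'‖ < R + r := by simpa using hx'.1
    have h2 : R ≤ ‖x'‖ := by simpa using hx'.2
    have h3 : ‖(‖x'‖ / R) • x‖ = ‖x'‖ := by
      rw [norm_smul, Real.norm_of_nonneg (by positivity), ← hR]; field_simp
    -- Rotate x' onto the ray through x; the centres are then less than r apart.
    rw [← setLIntegral_ball_eq_of_norm_eq φ h3]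
    refine lintegral_mono_set (ball_subset_ball' ?_)
    have : x - (‖x'‖ / R) • x = (1 - ‖x'‖ / R) • x := by rw [sub_smul, one_smul]
    rw [dist_eq_norm, this, norm_smul, ← hR, Real.norm_eq_abs, abs_of_nonpos]
    · have : -(1 - ‖x'‖ / R) * R = ‖x'‖ - R := by field_simp; ring
      linarith
    · rw [sub_nonpos, le_div_iff₀ hR0]; linarith
  have hmeas : Measurable (fun q : (𝔼 d) × (𝔼 d) =>
      T.indicator (fun y => φ ‖y‖) q.2 * {q : (𝔼 d) × (𝔼 d) | dist q.1 q.2 < 2 * r}.indicator 1 q) := by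
    refine Measurable.mul ?_ (measurable_one.indicator ?_)
    · exact ((hφ.comp measurable_norm).indicator hTm).comp measurable_snd
    · exact measurableSet_lt (measurable_fst.dist measurable_snd) measurable_const
  have hmain : volume Sh * ∫⁻ y in ball x r, φ ‖y‖ ≤
      (∫⁻ y in T, φ ‖y‖) * (ENNReal.ofReal ((2 * r) ^ d) * ω) := by
    calc volume Sh * ∫⁻ y in ball x r, φ ‖y‖
        = ∫⁻ _x' in Sh, ∫⁻ y in ball x r, φ ‖y‖ := by rw [setLIntegral_const, mul_comm]
      _ ≤ ∫⁻ x' in Sh, ∫⁻ y in ball x' (2 * r), φ ‖y‖ := setLIntegral_mono' hShm hcomp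
      _ ≤ ∫⁻ x' in Sh, ∫⁻ y, T.indicator (fun y => φ ‖y‖) y *
            {q : (𝔼 d) × (𝔼 d) | dist q.1 q.2 < 2 * r}.indicator 1 (x', y) := by
          refine setLIntegral_mono' hShm fun x' hx' => ?_
          rw [← lintegral_indicator measurableSet_ball]
          refine lintegral_mono fun y => ?_
          by_cases hy : y ∈ ball x' (2 * r)
          · have h1 : ‖x'‖ < R + r := by simpa using hx'.1
            have h2 : R ≤ ‖x'‖ := by simpa using hx'.2
            have hy' : dist y x' < 2 * r := hy
            have hyT : y ∈ T := by
              rw [dist_eq_norm] at hy'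
              have e1 := norm_sub_norm_le y x'
              have e2 := norm_sub_norm_le x' y
              rw [norm_sub_rev] at e2
              constructor <;> linarith
            rw [indicator_of_mem hy, indicator_of_mem hyT, indicator_of_mem]
            · simp
            · rw [dist_comm] at hy'; exact hy'
          · rw [indicator_of_notMem hy]; exact zero_le
      _ ≤ ∫⁻ x', ∫⁻ y, T.indicator (fun y => φ ‖y‖) y *
            {q : (𝔼 d) × (𝔼 d) | dist q.1 q.2 < 2 * r}.indicator 1 (x', y) :=
          setLIntegral_le_lintegral _ _
      _ = ∫⁻ y, ∫⁻ x', T.indicator (fun y => φ ‖y‖) y *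
            {q : (𝔼 d) × (𝔼 d) | dist q.1 q.2 < 2 * r}.indicator 1 (x', y) :=
          lintegral_lintegral_swap hmeas.aemeasurable
      _ = ∫⁻ y, T.indicator (fun y => φ ‖y‖) y * (ENNReal.ofReal ((2 * r) ^ d) * ω) := by
          refine lintegral_congr fun y => ?_
          rw [← volume_ball_pos_radius y (by positivity : 0 < 2 * r), lintegral_const_mul]
          · congr 1
            rw [← lintegral_indicator_one measurableSet_ball]
            refine lintegral_congr fun x' => ?_
            by_cases h : dist x' y < 2 * r <;> simp [indicator, h]
          · refine measurable_one.indicator ?_ |>.comp (measurable_id.prodMk measurable_const)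
            exact measurableSet_lt (measurable_fst.dist measurable_snd) measurable_const
      _ = _ := by
          rw [lintegral_mul_const _ ((by fun_prop : Measurable fun y : 𝔼 d => φ ‖y‖).indicator hTm),
            lintegral_indicator hTm]
  have hc : (0 : ℝ) < r * R ^ (d - 1) := by positivity
  have h3 := (mul_le_mul_left hvol (∫⁻ y in ball x r, φ ‖y‖)).trans hmain
  have h4 : (2 * r) ^ d = (r * R ^ (d - 1)) * (2 ^ d * (r / R) ^ (d - 1)) := by
    obtain ⟨n, rfl⟩ : ∃ n, d = n + 1 := ⟨d - 1, by omega⟩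
    simp only [Nat.add_sub_cancel, div_pow, mul_pow, pow_succ]
    field_simp
  rw [h4, ENNReal.ofReal_mul hc.le] at h3
  have hk : ENNReal.ofReal (r * R ^ (d - 1)) * ω ≠ 0 :=
    mul_ne_zero (by simpa using hc) hω0
  have hk' : ENNReal.ofReal (r * R ^ (d - 1)) * ω ≠ ∞ := ENNReal.mul_ne_top (by simp) hωt
  rw [← ENNReal.mul_le_mul_iff_right hk hk']
  refine h3.trans (le_of_eq ?_)
  ring

/-- Averaging a radial function over dilations by `‖z‖`, `z ∈ A`, contracts its weighted integral
when `‖z‖ ^ (-(κ + d)) ≤ K` on `A`. -/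
theorem lintegral_dilation_average_le {d : ℕ} {φ : ℝ → ℝ≥0∞} (hφ : Measurable φ) {κ K : ℝ}
    {A : Set (𝔼 d)} (hA : MeasurableSet A) (hA0 : ∀ z ∈ A, z ≠ 0)
    (hK : ∀ z ∈ A, ‖z‖ ^ (-(κ + d)) ≤ K) :
    ∫⁻ x : 𝔼 d, ENNReal.ofReal (‖x‖ ^ κ) * ∫⁻ z in A, φ (‖x‖ * ‖z‖) ≤
      ENNReal.ofReal K * volume A * ∫⁻ x : 𝔼 d, ENNReal.ofReal (‖x‖ ^ κ) * φ ‖x‖ := by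
  have hm : Measurable (fun q : (𝔼 d) × (𝔼 d) =>
      ENNReal.ofReal (‖q.1‖ ^ κ) * φ (‖q.1‖ * ‖q.2‖)) := by fun_prop
  calc ∫⁻ x : 𝔼 d, ENNReal.ofReal (‖x‖ ^ κ) * ∫⁻ z in A, φ (‖x‖ * ‖z‖)
      = ∫⁻ x : 𝔼 d, ∫⁻ z in A, ENNReal.ofReal (‖x‖ ^ κ) * φ (‖x‖ * ‖z‖) := by
        refine lintegral_congr fun x => ?_
        rw [lintegral_const_mul]
        fun_prop
    _ = ∫⁻ z in A, ∫⁻ x : 𝔼 d, ENNReal.ofReal (‖x‖ ^ κ) * φ (‖x‖ * ‖z‖) :=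
        lintegral_lintegral_swap hm.aemeasurable
    _ ≤ ∫⁻ _z in A, ENNReal.ofReal K * ∫⁻ x : 𝔼 d, ENNReal.ofReal (‖x‖ ^ κ) * φ ‖x‖ := by
        refine setLIntegral_mono' hA fun z hz => ?_
        have hz0 : 0 < ‖z‖ := norm_pos_iff.2 (hA0 z hz)
        have h1 := lintegral_comp_pos_smul (d := d) hz0
          (g := fun x => ENNReal.ofReal ((‖x‖ / ‖z‖) ^ κ) * φ ‖x‖) (by fun_prop)
        have h2 : ∀ x : 𝔼 d, ‖‖z‖ • x‖ = ‖x‖ * ‖z‖ := fun x => by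
          rw [norm_smul, norm_norm, mul_comm]
        have h3 : ∀ x : 𝔼 d, ‖x‖ * ‖z‖ / ‖z‖ = ‖x‖ := fun x => by field_simp
        simp only [h2, h3] at h1
        rw [h1]
        have h4 : ∀ x : 𝔼 d, ENNReal.ofReal ((‖x‖ / ‖z‖) ^ κ) * φ ‖x‖ =
            ENNReal.ofReal (‖z‖ ^ (-κ)) * (ENNReal.ofReal (‖x‖ ^ κ) * φ ‖x‖) := fun x => by
          rw [Real.div_rpow (norm_nonneg _) hz0.le, div_eq_mul_inv, ← Real.rpow_neg hz0.le,
            mul_comm (‖x‖ ^ κ), ENNReal.ofReal_mul (by positivity), mul_assoc]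
        simp only [h4]
        rw [lintegral_const_mul _ (by fun_prop), ← mul_assoc, ← ENNReal.ofReal_mul (by positivity)]
        gcongr
        refine le_trans (le_of_eq ?_) (hK z hz)
        rw [neg_add, Real.rpow_add hz0, mul_comm, Real.rpow_neg hz0.le (d : ℝ), Real.rpow_natCast]
    _ = _ := by rw [setLIntegral_const]; ring

/-! ### Measurable radial profiles -/

/-- An almost everywhere measurable radial function has a measurable radial representative. -/
theorem exists_measurable_radial_representative {d : ℕ} [Nontrivial (𝔼 d)] {u : (𝔼 d) → ℝ}
    (hu : AEMeasurable u) (hr : IsRadial u) :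
    ∃ f : ℝ → ℝ, Measurable f ∧ ∀ᵐ x : 𝔼 d, u x = f ‖x‖ := by
  obtain ⟨f, hf⟩ := hr
  set u₀ := hu.mk u
  have hu₀ : Measurable u₀ := hu.measurable_mk
  have hfu : ∀ᵐ x : 𝔼 d, u₀ x = f ‖x‖ := by
    filter_upwards [hf, hu.ae_eq_mk] with x h1 h2
    rw [← h1, h2]
  set e := homeomorphUnitSphereProd (𝔼 d)
  have hmp := (volume : Measure (𝔼 d)).measurePreserving_homeomorphUnitSphereProd
  have hmps : MeasurePreserving e.symm _ _ := hmp.symm e.toMeasurableEquiv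
  have hsub : ∀ {p : (𝔼 d) → Prop}, (∀ᵐ x, p x) ↔
      ∀ᵐ x : ({0}ᶜ : Set (𝔼 d)) ∂(Measure.comap Subtype.val volume), p x := by
    intro p
    rw [← ae_restrict_iff_subtype (measurableSet_singleton 0).compl,
      restrict_compl_singleton]
  have hprod := hmps.quasiMeasurePreserving.ae (hsub.1 hfu)
  have hval : ∀ q : sphere (0 : 𝔼 d) 1 × Ioi (0 : ℝ), ((e.symm q : ({0}ᶜ : Set (𝔼 d))) : 𝔼 d) =
      (q.2 : ℝ) • (q.1 : 𝔼 d) := fun q => homeomorphUnitSphereProd_symm_apply_coe _ q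
  have hnorm : ∀ q : sphere (0 : 𝔼 d) 1 × Ioi (0 : ℝ), ‖(q.2 : ℝ) • (q.1 : 𝔼 d)‖ = q.2 := fun q => by
    have h2 : (0 : ℝ) < q.2 := q.2.2
    simp [norm_smul, abs_of_pos h2]
  simp only [hval, hnorm] at hprod
  have hsec := Measure.ae_ae_of_ae_prod hprod
  have hne : (ae (volume : Measure (𝔼 d)).toSphere).NeBot :=
    ae_neBot.2 (Measure.toSphere_ne_zero _)
  -- The profile in `IsRadial` may be non-measurable. By Fubini in polar coordinates, along almost
  -- every ray a measurable version of u agrees with it for almost every radius; the restriction to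
  -- one such ray serves as the profile.
  obtain ⟨ω, hω⟩ := hsec.exists
  refine ⟨fun t => u₀ (t • (ω : 𝔼 d)), hu₀.comp (measurable_id.smul_const _), ?_⟩
  have hsnd := Measure.quasiMeasurePreserving_snd
    (μ := (volume : Measure (𝔼 d)).toSphere) |>.ae hω
  have hback := hmp.quasiMeasurePreserving.ae hsnd
  have hnice : ∀ᵐ x : 𝔼 d, u₀ (‖x‖ • (ω : 𝔼 d)) = f ‖x‖ := by
    rw [hsub]
    filter_upwards [hback] with x hx
    simpa using hx
  filter_upwards [hnice, hf] with x h1 h2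
  rw [h1, h2]

/-! ### The seminorm density and comparison with averages -/

/-- The inner integral of the weighted fractional seminorm, as a function of the weighted point. -/
noncomputable def fracDensity {d : ℕ} (s p α Λ : ℝ) (g : (𝔼 d) → ℝ) (x : 𝔼 d) : ℝ≥0∞ :=
  ∫⁻ y : 𝔼 d, ENNReal.ofReal
    (|g x - g y| ^ p * ‖x‖ ^ (α * p) / ‖x - y‖ ^ ((d : ℝ) + s * p) * chiCut Λ ‖x‖ ‖y‖)

theorem measurable_chiCut (Λ : ℝ) : Measurable (fun q : ℝ × ℝ => chiCut Λ q.1 q.2) := by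
  unfold chiCut
  refine Measurable.ite ?_ measurable_const measurable_const
  exact (measurableSet_le (measurable_fst.const_mul _) measurable_snd).inter
    (measurableSet_le measurable_snd (measurable_fst.const_mul _))

theorem measurable_fracIntegrand {d : ℕ} (s p α Λ : ℝ) {g : (𝔼 d) → ℝ} (hg : Measurable g) :
    Measurable (fun q : (𝔼 d) × (𝔼 d) => ENNReal.ofReal
      (|g q.1 - g q.2| ^ p * ‖q.1‖ ^ (α * p) / ‖q.1 - q.2‖ ^ ((d : ℝ) + s * p) *
        chiCut Λ ‖q.1‖ ‖q.2‖)) := by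
  have h : Measurable (fun q : (𝔼 d) × (𝔼 d) => chiCut Λ ‖q.1‖ ‖q.2‖) :=
    (measurable_chiCut Λ).comp (g := fun q : ℝ × ℝ => chiCut Λ q.1 q.2)
      (f := fun q : (𝔼 d) × (𝔼 d) => (‖q.1‖, ‖q.2‖)) (by fun_prop)
  fun_prop

theorem measurable_fracDensity {d : ℕ} (s p α Λ : ℝ) {g : (𝔼 d) → ℝ} (hg : Measurable g) :
    Measurable (fracDensity s p α Λ g) :=
  (measurable_fracIntegrand s p α Λ hg).lintegral_prod_right'

theorem fracSeminorm_eq_lintegral_fracDensity {d : ℕ} (s p α Λ : ℝ) {g : (𝔼 d) → ℝ}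
    (hg : Measurable g) :
    fracSeminorm s p α Λ g = (∫⁻ x, fracDensity s p α Λ g x) ^ (1 / p) := by
  unfold fracSeminorm fracDensity
  rw [lintegral_lintegral_swap]
  exact ((measurable_fracIntegrand s p α Λ hg).comp measurable_swap).aemeasurable

/-- Comparison of the value of `u` at `x` with its average over a set `S`. -/
theorem enorm_le_fracDensity_add_average {d : ℕ} {s p α Λ τ ρ : ℝ} (hs : 0 < s) (hp : 1 < p)
    (hτ : 1 ≤ τ) {u : (𝔼 d) → ℝ} (hu : Measurable u) {x : 𝔼 d} (hx : x ≠ 0)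
    {S : Set (𝔼 d)} (hS : MeasurableSet S) (hS0 : volume S ≠ 0) (hSt : volume S ≠ ∞)
    (hΛ : ∀ y ∈ S, Λ⁻¹ * ‖x‖ ≤ ‖y‖ ∧ ‖y‖ ≤ Λ * ‖x‖) (hρ : ∀ y ∈ S, ‖x - y‖ ≤ ρ) :
    ‖u x‖ₑ ≤ ((volume S)⁻¹ * (ENNReal.ofReal (ρ ^ (d + s * p) * ‖x‖ ^ (-(α * p))) *
        fracDensity s p α Λ u x)) ^ (1 / p) +
      ((volume S)⁻¹ * ∫⁻ y in S, ‖u y‖ₑ ^ τ) ^ (1 / τ) := by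
  have hx0 : 0 < ‖x‖ := norm_pos_iff.2 hx
  set ν : Measure (𝔼 d) := (volume S)⁻¹ • volume.restrict S with hν
  have hprob : IsProbabilityMeasure ν := ⟨by
    rw [hν, Measure.smul_apply, Measure.restrict_apply_univ, smul_eq_mul,
      ENNReal.inv_mul_cancel hS0 hSt]⟩
  calc ‖u x‖ₑ = ∫⁻ _y, ‖u x‖ₑ ∂ν := by simp
    _ ≤ ∫⁻ y, (‖u x - u y‖ₑ + ‖u y‖ₑ) ∂ν := by
        refine lintegral_mono fun y => ?_
        simpa using enorm_add_le (u x - u y) (u y)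
    _ = ∫⁻ y, ‖u x - u y‖ₑ ∂ν + ∫⁻ y, ‖u y‖ₑ ∂ν := lintegral_add_right _ (by fun_prop)
    _ ≤ (∫⁻ y, ‖u x - u y‖ₑ ^ p ∂ν) ^ (1 / p) + (∫⁻ y, ‖u y‖ₑ ^ τ ∂ν) ^ (1 / τ) :=
        add_le_add (lintegral_le_rpow_lintegral_rpow ν (by fun_prop) hp.le)
          (lintegral_le_rpow_lintegral_rpow ν (by fun_prop) hτ)
    _ ≤ _ := by
        rw [hν, lintegral_smul_measure, lintegral_smul_measure, smul_eq_mul, smul_eq_mul]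
        gcongr
        rw [fracDensity, ← lintegral_const_mul' _ _ ENNReal.ofReal_ne_top]
        refine le_trans (setLIntegral_mono' hS fun y hy => ?_) (setLIntegral_le_lintegral S _)
        rw [chiCut, if_pos (hΛ y hy), mul_one, ← ENNReal.ofReal_mul' (by positivity),
          Real.enorm_eq_ofReal_abs,
          ENNReal.ofReal_rpow_of_nonneg (abs_nonneg _) (by linarith)]
        apply ENNReal.ofReal_le_ofReal
        -- On the diagonal the kernel is a division by zero, but the difference to be bounded
        -- vanishes since p ≠ 0.
        rcases eq_or_ne x y with rfl | hxy
        · have : p ≠ 0 := by linarith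
          simp [Real.zero_rpow this]
        · have hxy0 : 0 < ‖x - y‖ := norm_pos_iff.2 (sub_ne_zero.2 hxy)
          have h1 : ‖x - y‖ ^ (d + s * p) ≤ ρ ^ (d + s * p) :=
            Real.rpow_le_rpow hxy0.le (hρ y hy) (by positivity)
          rw [Real.rpow_neg hx0.le]
          have h2 : 0 < ‖x‖ ^ (α * p) := Real.rpow_pos_of_pos hx0 _
          have h3 : 0 < ‖x - y‖ ^ (d + s * p) := Real.rpow_pos_of_pos hxy0 _
          have h4 : 0 ≤ |u x - u y| ^ p := by positivity
          rw [show ρ ^ (d + s * p) * (‖x‖ ^ (α * p))⁻¹ *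
            (|u x - u y| ^ p * ‖x‖ ^ (α * p) / ‖x - y‖ ^ (d + s * p)) =
            |u x - u y| ^ p * (ρ ^ (d + s * p) / ‖x - y‖ ^ (d + s * p)) by field_simp]
          exact le_mul_of_one_le_right h4 ((one_le_div h3).2 h1)

/-! ### Pointwise bounds at the two scales -/

/-- The weighted integral `∫ |x|^κ |f(|x|)|^τ dx` of a radial function. -/
noncomputable def radialIntegral (d : ℕ) (κ τ : ℝ) (f : ℝ → ℝ) : ℝ≥0∞ :=
  ∫⁻ x : 𝔼 d, ENNReal.ofReal (‖x‖ ^ κ) * ‖f ‖x‖‖ₑ ^ τ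

/-- The average of `|f(R |z|)|^τ` over `z ∈ A`. -/
noncomputable def dilationAverage {d : ℕ} (A : Set (𝔼 d)) (τ : ℝ) (f : ℝ → ℝ) (R : ℝ) : ℝ≥0∞ :=
  (volume A)⁻¹ * ∫⁻ z in A, ‖f (R * ‖z‖)‖ₑ ^ τ

theorem one_le_rpow_mul_of_mem_annulus {R t κ : ℝ} (hR : 0 < R) (h1 : R / 2 ≤ t)
    (h2 : t ≤ 2 * R) : 1 ≤ 2 ^ |κ| * R ^ (-κ) * t ^ κ := by
  have ht : 0 < t := by linarith
  have h3 : R ^ (-κ) * t ^ κ = (t / R) ^ κ := by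
    rw [Real.div_rpow ht.le hR.le, Real.rpow_neg hR.le]; field_simp
  have h4 : 1 / 2 ≤ t / R := by rw [le_div_iff₀ hR]; linarith
  have h5 : t / R ≤ 2 := by rw [div_le_iff₀ hR]; linarith
  have h6 : 0 < t / R := by positivity
  rw [mul_assoc, h3]
  rcases le_total 0 κ with h | h
  · rw [abs_of_nonneg h, ← Real.mul_rpow (by norm_num) h6.le]
    exact Real.one_le_rpow (by linarith) h
  · rw [abs_of_nonpos h, Real.rpow_neg (by norm_num), ← Real.inv_rpow (by norm_num),
      ← Real.mul_rpow (by norm_num) h6.le]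
    exact Real.one_le_rpow_of_pos_of_le_one_of_nonpos (by positivity) (by linarith) h

theorem volume_ball_zero_one_pos (d : ℕ) : 0 < (volume (ball (0 : 𝔼 d) 1)).toReal :=
  ENNReal.toReal_pos (measure_ball_pos _ _ one_pos).ne' measure_ball_lt_top.ne

/-- Small-scale bound: the ball average has prefactor r^(-d), and the annulus estimate returns
r^(d-1), leaving r^(-1/τ) after the τ-th root. On the annulus the weight is comparable to its value
at |x|. -/
theorem abs_le_ball_bound {d : ℕ} (hd : 1 ≤ d) {s p α γ Λ τ : ℝ} (hs : 0 < s) (hp : 1 < p)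
    (hτ : 1 ≤ τ) (hΛ : 1 < Λ) :
    ∃ C c : ℝ, 0 < C ∧ 0 < c ∧ c ≤ 1 ∧ ∀ f : ℝ → ℝ, Measurable f →
      radialIntegral d (γ * τ) τ f ≠ ∞ → ∀ x : 𝔼 d, x ≠ 0 →
      fracDensity s p α Λ (fun y => f ‖y‖) x ≠ ∞ → ∀ r : ℝ, 0 < r → r ≤ c * ‖x‖ →
      |f ‖x‖| ≤ C * (r ^ s *
          (‖x‖ ^ (-α) * (fracDensity s p α Λ (fun y => f ‖y‖) x).toReal ^ (1 / p)) +
        r ^ (-(1 / τ)) * (‖x‖ ^ (-((d - 1) / τ) - γ) *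
          (radialIntegral d (γ * τ) τ f).toReal ^ (1 / τ))) := by
  have hτ0 : 0 < τ := by linarith
  have hp0 : 0 < p := by linarith
  set ω := (volume (ball (0 : 𝔼 d) 1)).toReal with hω
  have hω0 : 0 < ω := volume_ball_zero_one_pos d
  set C₂ : ℝ := ω⁻¹ * 2 ^ d * 2 ^ |γ * τ| with hC₂
  -- The radius bound 1/6 is what the annulus estimate needs; 1 - Λ⁻¹ keeps the ball inside the
  -- region where `chiCut` equals 1.
  refine ⟨ω⁻¹ ^ (1 / p) + C₂ ^ (1 / τ), min (1 / 6) (1 - Λ⁻¹), by positivity,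
    lt_min (by norm_num) (sub_pos.2 (inv_lt_one_of_one_lt₀ hΛ)),
    (min_le_left _ _).trans (by norm_num), ?_⟩
  intro f hf hP x hx hG r hr hrx
  set R := ‖x‖ with hR
  have hR0 : 0 < R := norm_pos_iff.2 hx
  set G := fracDensity s p α Λ (fun y : 𝔼 d => f ‖y‖) x with hGdef
  set P := radialIntegral d (γ * τ) τ f with hPdef
  have hr6 : 6 * r ≤ R := by
    have := hrx.trans (mul_le_mul_of_nonneg_right (min_le_left _ _) hR0.le)
    linarith
  have hrΛ : r ≤ (1 - Λ⁻¹) * R :=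
    hrx.trans (mul_le_mul_of_nonneg_right (min_le_right _ _) hR0.le)
  have hΛ2 : 1 - Λ⁻¹ ≤ Λ - 1 := by
    have h0 : 0 < Λ := by linarith
    have : 2 - Λ - Λ⁻¹ = -((Λ - 1) ^ 2 / Λ) := by field_simp; ring
    have h3 : 0 ≤ (Λ - 1) ^ 2 / Λ := by positivity
    linarith
  have hSvol : volume (ball x r) = ENNReal.ofReal (r ^ d * ω) := by
    rw [volume_ball_pos_radius x hr, ENNReal.ofReal_mul (by positivity), hω,
      ENNReal.ofReal_toReal measure_ball_lt_top.ne]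
  have hbase := enorm_le_fracDensity_add_average (α := α) (Λ := Λ) (ρ := r) hs hp hτ
    (u := fun y : 𝔼 d => f ‖y‖) (by fun_prop) hx (S := ball x r) measurableSet_ball
    (measure_ball_pos _ _ hr).ne' measure_ball_lt_top.ne (fun y hy => by
      have hy' : ‖y - x‖ < r := by simpa [dist_eq_norm] using hy
      have e1 := norm_sub_norm_le y x
      have e2 := norm_sub_norm_le x y
      rw [norm_sub_rev] at e2
      constructor
      · nlinarith
      · nlinarith) (fun y hy => by
      have hy' : ‖y - x‖ < r := by simpa [dist_eq_norm] using hy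
      rw [norm_sub_rev]; exact hy'.le)
  have hann : ∫⁻ y in ball x r, ‖f ‖y‖‖ₑ ^ τ ≤
      ENNReal.ofReal (2 ^ d * (r / R) ^ (d - 1) * (2 ^ |γ * τ| * R ^ (-(γ * τ))) * P.toReal) := by
    refine (lintegral_ball_le_annulus hd (φ := fun t => ‖f t‖ₑ ^ τ) (by fun_prop) hr hr6).trans ?_
    rw [mul_assoc (2 ^ d * (r / R) ^ (d - 1)),
      ENNReal.ofReal_mul (p := 2 ^ d * (r / R) ^ (d - 1)) (by positivity)]
    refine mul_le_mul' le_rfl ?_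
    rw [ENNReal.ofReal_mul (by positivity), ENNReal.ofReal_toReal hP, hPdef, radialIntegral,
      ← lintegral_const_mul' _ _ ENNReal.ofReal_ne_top]
    refine le_trans (setLIntegral_mono' ?_ fun y hy => ?_) (setLIntegral_le_lintegral _ _)
    · exact (measurableSet_le measurable_const measurable_norm).inter
        (measurableSet_le measurable_norm measurable_const)
    · rw [← mul_assoc, ← ENNReal.ofReal_mul (by positivity)]
      refine le_mul_of_one_le_left zero_le ?_
      rw [ENNReal.one_le_ofReal]
      exact one_le_rpow_mul_of_mem_annulus hR0 hy.1 hy.2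
  have hrw1 : (volume (ball x r))⁻¹ * (ENNReal.ofReal (r ^ (d + s * p) * R ^ (-(α * p))) * G) =
      ENNReal.ofReal (ω⁻¹ * r ^ (s * p) * R ^ (-(α * p)) * G.toReal) := by
    rw [hSvol, ← ENNReal.ofReal_inv_of_pos (by positivity), ← ENNReal.ofReal_toReal hG,
      ← ENNReal.ofReal_mul (by positivity), ← ENNReal.ofReal_mul (by positivity),
      ENNReal.toReal_ofReal ENNReal.toReal_nonneg, Real.rpow_add hr, Real.rpow_natCast]
    congr 1
    field_simp
  have hrw2 : (volume (ball x r))⁻¹ * ∫⁻ y in ball x r, ‖f ‖y‖‖ₑ ^ τ ≤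
      ENNReal.ofReal (C₂ * r⁻¹ * R ^ (-(d - 1) - γ * τ) * P.toReal) := by
    refine (mul_le_mul_right hann _).trans (le_of_eq ?_)
    rw [hSvol, ← ENNReal.ofReal_inv_of_pos (by positivity), ← ENNReal.ofReal_mul (by positivity)]
    congr 1
    have h1 : R ^ (-((d : ℝ) - 1) - γ * τ) = (R ^ (d - 1))⁻¹ * R ^ (-(γ * τ)) := by
      rw [sub_eq_add_neg, Real.rpow_add hR0, Real.rpow_neg hR0.le, ← Real.rpow_natCast,
        Nat.cast_sub hd, Nat.cast_one]
    obtain ⟨n, rfl⟩ : ∃ n, d = n + 1 := ⟨d - 1, by omega⟩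
    rw [h1, hC₂, div_pow]
    simp only [Nat.add_sub_cancel, pow_succ r]
    field_simp
  have hfin : ENNReal.ofReal |f R| ≤ ENNReal.ofReal
      ((ω⁻¹ * r ^ (s * p) * R ^ (-(α * p)) * G.toReal) ^ (1 / p) +
        (C₂ * r⁻¹ * R ^ (-(d - 1) - γ * τ) * P.toReal) ^ (1 / τ)) := by
    rw [← Real.enorm_eq_ofReal_abs, ENNReal.ofReal_add (by positivity) (by positivity),
      ← ENNReal.ofReal_rpow_of_nonneg (by positivity) (by positivity),
      ← ENNReal.ofReal_rpow_of_nonneg (by positivity) (by positivity), ← hrw1]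
    refine hbase.trans ?_
    gcongr
  rw [ENNReal.ofReal_le_ofReal_iff (by positivity)] at hfin
  have e1 : (ω⁻¹ * r ^ (s * p) * R ^ (-(α * p)) * G.toReal) ^ (1 / p) =
      ω⁻¹ ^ (1 / p) * (r ^ s * (R ^ (-α) * G.toReal ^ (1 / p))) := by
    rw [Real.mul_rpow (by positivity) (by positivity), Real.mul_rpow (by positivity) (by positivity),
      Real.mul_rpow (by positivity) (by positivity), ← Real.rpow_mul hr.le, ← Real.rpow_mul hR0.le]
    rw [show s * p * (1 / p) = s by field_simp, show -(α * p) * (1 / p) = -α by field_simp]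
    ring
  have e2 : (C₂ * r⁻¹ * R ^ (-((d : ℝ) - 1) - γ * τ) * P.toReal) ^ (1 / τ) =
      C₂ ^ (1 / τ) * (r ^ (-(1 / τ)) * (R ^ (-(((d : ℝ) - 1) / τ) - γ) * P.toReal ^ (1 / τ))) := by
    rw [Real.mul_rpow (by positivity) (by positivity), Real.mul_rpow (by positivity) (by positivity),
      Real.mul_rpow (by positivity) (by positivity), ← Real.rpow_mul hR0.le,
      Real.inv_rpow hr.le, ← Real.rpow_neg hr.le]
    rw [show (-((d : ℝ) - 1) - γ * τ) * (1 / τ) = -(((d : ℝ) - 1) / τ) - γ by field_simp]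
    ring
  rw [e1, e2] at hfin
  refine hfin.trans ?_
  have k1 : 0 ≤ r ^ s * (R ^ (-α) * G.toReal ^ (1 / p)) := by positivity
  have k2 : 0 ≤ r ^ (-(1 / τ)) * (R ^ (-(((d : ℝ) - 1) / τ) - γ) * P.toReal ^ (1 / τ)) := by
    positivity
  have k3 : 0 ≤ ω⁻¹ ^ (1 / p) := by positivity
  have k4 : 0 ≤ C₂ ^ (1 / τ) := by positivity
  nlinarith [mul_nonneg k3 k2, mul_nonneg k4 k1]

/-- Large-scale bound. The average over the dilated set |x|A must keep coefficient 1, since any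
larger fixed constant could destroy the contraction needed for absorption. -/
theorem abs_le_dilation_bound {d : ℕ} {s p α Λ τ : ℝ} (hs : 0 < s) (hp : 1 < p)
    (hτ : 1 ≤ τ) (hΛ : 1 < Λ) {A : Set (𝔼 d)} (hA : MeasurableSet A) (hA0 : volume A ≠ 0)
    (hAΛ : ∀ z ∈ A, Λ⁻¹ ≤ ‖z‖ ∧ ‖z‖ ≤ Λ) :
    ∃ C : ℝ, 0 < C ∧ ∀ f : ℝ → ℝ, Measurable f → ∀ x : 𝔼 d, x ≠ 0 →
      fracDensity s p α Λ (fun y => f ‖y‖) x ≠ ∞ → dilationAverage A τ f ‖x‖ ≠ ∞ →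
      |f ‖x‖| ≤ C * (‖x‖ ^ s *
          (‖x‖ ^ (-α) * (fracDensity s p α Λ (fun y => f ‖y‖) x).toReal ^ (1 / p))) +
        (dilationAverage A τ f ‖x‖).toReal ^ (1 / τ) := by
  have hτ0 : 0 < τ := by linarith
  have hp0 : 0 < p := by linarith
  have hΛ0 : 0 < Λ := by linarith
  have hAt : volume A ≠ ∞ := by
    refine ne_top_of_le_ne_top (measure_closedBall_lt_top (x := (0 : 𝔼 d)) (r := Λ)).ne
      (measure_mono fun z hz => ?_)
    simpa using (hAΛ z hz).2
  set V := (volume A).toReal with hV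
  have hV0 : 0 < V := ENNReal.toReal_pos hA0 hAt
  refine ⟨(V⁻¹ * (1 + Λ) ^ (d + s * p)) ^ (1 / p), by positivity, ?_⟩
  intro f hf x hx hG hT
  set R := ‖x‖ with hR
  have hR0 : 0 < R := norm_pos_iff.2 hx
  set G := fracDensity s p α Λ (fun y : 𝔼 d => f ‖y‖) x with hGdef
  set S : Set (𝔼 d) := (fun y => R⁻¹ • y) ⁻¹' A with hSdef
  have hSm : MeasurableSet S := (measurable_const_smul (R⁻¹)) hA
  have hRi : 0 < R⁻¹ := by positivity
  have hscale : ∀ {ψ : (𝔼 d) → ℝ≥0∞}, Measurable ψ →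
      ∫⁻ y in S, ψ (R⁻¹ • y) = ENNReal.ofReal (R ^ d) * ∫⁻ z in A, ψ z := by
    intro ψ hψ
    rw [← lintegral_indicator hSm, ← lintegral_indicator hA]
    have := lintegral_comp_pos_smul (d := d) hRi (hψ.indicator hA)
    rw [inv_pow, inv_inv] at this
    rw [← this]
    rfl
  have hSvol : volume S = ENNReal.ofReal (R ^ d) * volume A := by
    have := hscale (ψ := fun _ => 1) measurable_const
    simpa using this
  have hRd : ENNReal.ofReal (R ^ d) ≠ 0 := by simp; positivity
  have hy : ∀ y ∈ S, Λ⁻¹ * R ≤ ‖y‖ ∧ ‖y‖ ≤ Λ * R := by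
    intro y hy
    have h := hAΛ _ hy
    rw [norm_smul, Real.norm_of_nonneg hRi.le, inv_mul_eq_div, le_div_iff₀ hR0,
      div_le_iff₀ hR0] at h
    exact h
  have hbase := enorm_le_fracDensity_add_average (α := α) (Λ := Λ) (ρ := (1 + Λ) * R) hs hp hτ
    (u := fun y : 𝔼 d => f ‖y‖) (by fun_prop) hx (S := S) hSm
    (by rw [hSvol]; exact mul_ne_zero hRd hA0)
    (by rw [hSvol]; exact ENNReal.mul_ne_top ENNReal.ofReal_ne_top hAt) hy
    (fun y hy' => by
      have := norm_sub_le x y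
      have := (hy y hy').2
      linarith)
  have havg : (volume S)⁻¹ * ∫⁻ y in S, ‖f ‖y‖‖ₑ ^ τ = dilationAverage A τ f R := by
    have h1 := hscale (ψ := fun z => ‖f (R * ‖z‖)‖ₑ ^ τ) (by fun_prop)
    have h2 : ∀ y : 𝔼 d, R * ‖R⁻¹ • y‖ = ‖y‖ := fun y => by
      rw [norm_smul, Real.norm_of_nonneg hRi.le]; field_simp
    simp only [h2] at h1
    rw [h1, hSvol, dilationAverage, ENNReal.mul_inv (Or.inl hRd) (Or.inl ENNReal.ofReal_ne_top),
      mul_comm (ENNReal.ofReal (R ^ d))⁻¹, mul_assoc, ← mul_assoc (ENNReal.ofReal (R ^ d))⁻¹,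
      ENNReal.inv_mul_cancel hRd ENNReal.ofReal_ne_top, one_mul]
  have hrw1 : (volume S)⁻¹ * (ENNReal.ofReal (((1 + Λ) * R) ^ (d + s * p) * R ^ (-(α * p))) * G) =
      ENNReal.ofReal (V⁻¹ * (1 + Λ) ^ (d + s * p) * R ^ (s * p) * R ^ (-(α * p)) * G.toReal) := by
    rw [hSvol, ← ENNReal.ofReal_toReal hAt, ← ENNReal.ofReal_mul (by positivity),
      ← ENNReal.ofReal_inv_of_pos (by positivity), ← ENNReal.ofReal_toReal hG,
      ← ENNReal.ofReal_mul (by positivity), ← ENNReal.ofReal_mul (by positivity),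
      ENNReal.toReal_ofReal ENNReal.toReal_nonneg, Real.mul_rpow (by positivity) hR0.le,
      Real.rpow_add hR0, Real.rpow_natCast]
    rw [← hV]
    congr 1
    field_simp
  have hfin : ENNReal.ofReal |f R| ≤ ENNReal.ofReal
      ((V⁻¹ * (1 + Λ) ^ (d + s * p) * R ^ (s * p) * R ^ (-(α * p)) * G.toReal) ^ (1 / p) +
        (dilationAverage A τ f R).toReal ^ (1 / τ)) := by
    rw [← Real.enorm_eq_ofReal_abs, ENNReal.ofReal_add (by positivity) (by positivity),
      ← ENNReal.ofReal_rpow_of_nonneg (by positivity) (by positivity),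
      ← ENNReal.ofReal_rpow_of_nonneg (by positivity) (by positivity), ← hrw1,
      ENNReal.ofReal_toReal hT, ← havg]
    exact hbase
  rw [ENNReal.ofReal_le_ofReal_iff (by positivity)] at hfin
  refine hfin.trans (le_of_eq ?_)
  congr 1
  rw [Real.mul_rpow (by positivity) (by positivity), Real.mul_rpow (by positivity) (by positivity),
    Real.mul_rpow (x := V⁻¹ * (1 + Λ) ^ (d + s * p)) (by positivity) (by positivity),
    ← Real.rpow_mul hR0.le, ← Real.rpow_mul hR0.le]
  rw [show s * p * (1 / p) = s by field_simp, show -(α * p) * (1 / p) = -α by field_simp]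
  ring

/-! ### Optimization in the radius and the product bound -/

/-- Optimization in `r` of the bound `r ^ s' * F + r ^ (-1/τ) * M` under the constraint
`r ≤ c * R`. -/
theorem le_add_mul_rpow_of_forall_radius {s' τ θ c C₁ C₂ R F M t U : ℝ} (hs' : 0 < s')
    (hτ : 0 < τ) (hθ : θ = 1 / (1 + s' * τ)) (hc : 0 < c) (hC₁ : 0 < C₁) (hC₂ : 0 < C₂)
    (hR : 0 < R) (hF : 0 ≤ F) (hM : 0 < M) (ht : 0 ≤ t)
    (h₁ : ∀ r, 0 < r → r ≤ c * R → U ≤ C₁ * (r ^ s' * F + r ^ (-(1 / τ)) * M))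
    (h₂ : U ≤ C₂ * (R ^ s' * F) + t) :
    U ≤ t + (2 * C₁ + C₂ * c ^ (-s')) * (F ^ θ * M ^ (1 - θ)) := by
  have hθ0 : 0 < θ := by rw [hθ]; positivity
  -- If F = 0 there is no optimal radius, but the large-scale bound already gives U ≤ t.
  rcases hF.eq_or_lt with rfl | hF
  · rw [Real.zero_rpow hθ0.ne']
    simpa using h₂
  have hθ' : s' * (τ * θ) = 1 - θ := by rw [hθ]; field_simp; ring
  -- The radius at which r^s' F and r^(-1/τ) M are equal.
  set r₀ := (M / F) ^ (τ * θ) with hr₀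
  have hr₀0 : 0 < r₀ := by positivity
  have e1 : r₀ ^ s' * F = F ^ θ * M ^ (1 - θ) := by
    rw [hr₀, ← Real.rpow_mul (by positivity), mul_comm (τ * θ), hθ', Real.div_rpow hM.le hF.le,
      Real.rpow_sub hF, Real.rpow_one]
    field_simp
  have e2 : r₀ ^ (-(1 / τ)) * M = F ^ θ * M ^ (1 - θ) := by
    rw [hr₀, ← Real.rpow_mul (by positivity), show τ * θ * -(1 / τ) = -θ by field_simp,
      Real.rpow_neg (by positivity), Real.div_rpow hM.le hF.le, Real.rpow_sub hM, Real.rpow_one]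
    field_simp
  have hY : 0 < F ^ θ * M ^ (1 - θ) := by positivity
  have hcs : 0 < c ^ (-s') := by positivity
  rcases le_or_gt r₀ (c * R) with h | h
  · have := h₁ r₀ hr₀0 h
    rw [e1, e2] at this
    have h3 : 0 ≤ C₂ * c ^ (-s') * (F ^ θ * M ^ (1 - θ)) := by positivity
    linarith
  -- The optimal radius is inadmissible, so R < r₀/c, and the oscillation term of the large-scale
  -- bound is itself controlled by the optimal value.
  · have h4 : R ^ s' * F ≤ c ^ (-s') * (F ^ θ * M ^ (1 - θ)) := by
      rw [← e1, ← mul_assoc]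
      gcongr
      rw [Real.rpow_neg hc.le, inv_mul_eq_div, le_div_iff₀ (by positivity), mul_comm,
        ← Real.mul_rpow hc.le hR.le]
      exact Real.rpow_le_rpow (by positivity) h.le hs'.le
    have h5 : C₂ * (R ^ s' * F) ≤ C₂ * (c ^ (-s') * (F ^ θ * M ^ (1 - θ))) := by gcongr
    have h6 : 0 < C₁ * (F ^ θ * M ^ (1 - θ)) := by positivity
    linarith

/-- If `U ≤ t + h`, then `U ^ τ` is controlled either by `t ^ τ` with a constant close to `1`, or
by an interpolation of `U` and `h`. -/
theorem rpow_le_of_le_add {U t h τ b η : ℝ} (hU : 0 ≤ U) (ht : 0 ≤ t) (hh : 0 ≤ h) (hτ : 0 < τ)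
    (hb0 : 0 < b) (hη : 1 < η) (hUth : U ≤ t + h) :
    U ^ τ ≤ η ^ τ * t ^ τ + U ^ ((1 - b) * τ) * (η / (η - 1) * h) ^ (b * τ) := by
  have hη1 : 0 < η - 1 := by linarith
  -- Either h is small relative to t and U ≤ ηt, or t is dominated by h and U ≤ η/(η-1) h; in the
  -- latter case only the fraction b of the power of U is replaced.
  rcases le_or_gt h ((η - 1) * t) with h1 | h1
  · have h2 : U ^ τ ≤ (η * t) ^ τ := Real.rpow_le_rpow hU (by linarith) hτ.le
    rw [Real.mul_rpow (by positivity) ht] at h2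
    have : 0 ≤ U ^ ((1 - b) * τ) * (η / (η - 1) * h) ^ (b * τ) := by positivity
    linarith
  · have h2 : U ≤ η / (η - 1) * h := by
      rw [div_mul_eq_mul_div, le_div_iff₀ hη1]
      nlinarith
    have h3 : 0 ≤ η ^ τ * t ^ τ := by positivity
    rcases hU.eq_or_lt with rfl | hU
    · rw [Real.zero_rpow hτ.ne']; positivity
    · have h4 : U ^ τ = U ^ ((1 - b) * τ) * U ^ (b * τ) := by
        rw [← Real.rpow_add hU]; congr 1; ring
      have h5 : U ^ (b * τ) ≤ (η / (η - 1) * h) ^ (b * τ) :=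
        Real.rpow_le_rpow hU.le h2 (by positivity)
      have h6 : U ^ ((1 - b) * τ) * U ^ (b * τ) ≤
          U ^ ((1 - b) * τ) * (η / (η - 1) * h) ^ (b * τ) := by gcongr
      linarith

/-- Since r ≤ |x|, the smoothness s can be lowered to s' at the price r^s ≤ r^s' |x|^(s-s'). This
freedom is what allows s' to be tuned to the balance law. -/
theorem abs_le_dilation_add_interpolation {d : ℕ} (hd : 1 ≤ d) {s s' p α γ Λ τ θ : ℝ}
    (hs' : 0 < s') (hss' : s' ≤ s) (hp : 1 < p) (hτ : 1 ≤ τ) (hΛ : 1 < Λ)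
    (hθ : θ = 1 / (1 + s' * τ)) {A : Set (𝔼 d)} (hA : MeasurableSet A) (hA0 : volume A ≠ 0)
    (hAΛ : ∀ z ∈ A, Λ⁻¹ ≤ ‖z‖ ∧ ‖z‖ ≤ Λ) :
    ∃ C : ℝ, 0 < C ∧ ∀ f : ℝ → ℝ, Measurable f →
      radialIntegral d (γ * τ) τ f ≠ 0 → radialIntegral d (γ * τ) τ f ≠ ∞ →
      ∀ x : 𝔼 d, x ≠ 0 →
      fracDensity s p α Λ (fun y => f ‖y‖) x ≠ ∞ → dilationAverage A τ f ‖x‖ ≠ ∞ →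
      |f ‖x‖| ≤ (dilationAverage A τ f ‖x‖).toReal ^ (1 / τ) + C *
        ((‖x‖ ^ (s - s' - α) *
          (fracDensity s p α Λ (fun y => f ‖y‖) x).toReal ^ (1 / p)) ^ θ *
        (‖x‖ ^ (-((d - 1) / τ) - γ) *
          (radialIntegral d (γ * τ) τ f).toReal ^ (1 / τ)) ^ (1 - θ)) := by
  have hs : 0 < s := by linarith
  obtain ⟨C₁, c, hC₁, hc, hc1, H₁⟩ := abs_le_ball_bound (α := α) (γ := γ) hd hs hp hτ hΛ
  obtain ⟨C₂, hC₂, H₂⟩ := abs_le_dilation_bound (α := α) hs hp hτ hΛ hA hA0 hAΛ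
  refine ⟨2 * C₁ + C₂ * c ^ (-s'), by positivity, ?_⟩
  intro f hf hP0 hP x hx hG hT
  have hR0 : 0 < ‖x‖ := norm_pos_iff.2 hx
  have hPr : 0 < (radialIntegral d (γ * τ) τ f).toReal := ENNReal.toReal_pos hP0 hP
  set Gr := (fracDensity s p α Λ (fun y : 𝔼 d => f ‖y‖) x).toReal ^ (1 / p) with hGr
  have hGr0 : 0 ≤ Gr := by positivity
  have hsplit : ‖x‖ ^ (s - s' - α) = ‖x‖ ^ (s - s') * ‖x‖ ^ (-α) := by
    rw [← Real.rpow_add hR0]; congr 1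
  refine le_add_mul_rpow_of_forall_radius hs' (by linarith) hθ hc hC₁ hC₂ hR0 (by positivity)
    (by positivity) (by positivity) (fun r hr hrx => (H₁ f hf hP x hx hG r hr hrx).trans ?_)
    ((H₂ f hf x hx hG hT).trans (le_of_eq ?_))
  · have h1 : r ^ s ≤ r ^ s' * ‖x‖ ^ (s - s') := by
      rw [show s = s' + (s - s') by ring, Real.rpow_add hr, show s' + (s - s') - s' = s - s' by ring]
      gcongr
      exact hrx.trans (mul_le_of_le_one_left hR0.le hc1)
    rw [← hGr, hsplit, mul_assoc (‖x‖ ^ (s - s')), ← mul_assoc (r ^ s')]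
    gcongr
  · rw [hsplit, mul_assoc (‖x‖ ^ (s - s')), ← mul_assoc (‖x‖ ^ s'), ← Real.rpow_add hR0,
      show s' + (s - s') = s by ring]

/-- The pointwise bound behind the absorption argument. -/
theorem weighted_rpow_le_dilation_add_product {d : ℕ} (hd : 1 ≤ d)
    {s s' p q α β γ Λ τ θ b η : ℝ}
    (hs' : 0 < s') (hss' : s' ≤ s) (hp : 1 < p) (hq : 1 ≤ q) (hτ : 1 ≤ τ) (hΛ : 1 < Λ)
    (hθ : θ = 1 / (1 + s' * τ)) (hb0 : 0 < b) (hb1 : b ≤ 1) (hη : 1 < η)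
    (hexp : γ + (s - s' - α) * θ * b + (-((d - 1) / τ) - γ) * (1 - θ) * b = β * (1 - b))
    {A : Set (𝔼 d)} (hA : MeasurableSet A) (hA0 : volume A ≠ 0)
    (hAΛ : ∀ z ∈ A, Λ⁻¹ ≤ ‖z‖ ∧ ‖z‖ ≤ Λ) :
    ∃ C : ℝ, 0 < C ∧ ∀ f : ℝ → ℝ, Measurable f →
      radialIntegral d (γ * τ) τ f ≠ 0 → radialIntegral d (γ * τ) τ f ≠ ∞ →
      ∀ x : 𝔼 d, x ≠ 0 →
      fracDensity s p α Λ (fun y => f ‖y‖) x ≠ ∞ → dilationAverage A τ f ‖x‖ ≠ ∞ →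
      ENNReal.ofReal (‖x‖ ^ (γ * τ)) * ‖f ‖x‖‖ₑ ^ τ ≤
        ENNReal.ofReal (η ^ τ) * (ENNReal.ofReal (‖x‖ ^ (γ * τ)) * dilationAverage A τ f ‖x‖) +
        ENNReal.ofReal C * radialIntegral d (γ * τ) τ f ^ ((1 - θ) * b) *
          (fracDensity s p α Λ (fun y => f ‖y‖) x ^ (θ * b * τ / p) *
            (ENNReal.ofReal (‖x‖ ^ (β * q)) * ‖f ‖x‖‖ₑ ^ q) ^ ((1 - b) * τ / q)) := by
  obtain ⟨C, hC, H⟩ := abs_le_dilation_add_interpolation (α := α) (γ := γ) hd hs' hss' hp hτ hΛ hθ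
    hA hA0 hAΛ
  have hτ0 : 0 < τ := by linarith
  have hp0 : 0 < p := by linarith
  have hq0 : 0 < q := by linarith
  have hη1 : 0 < η - 1 := by linarith
  have hθ0 : 0 < θ := by rw [hθ]; positivity
  have hθ1 : θ ≤ 1 := by rw [hθ, div_le_one (by positivity)]; nlinarith
  have h1θ : 0 ≤ 1 - θ := by linarith
  have h1b : 0 ≤ 1 - b := by linarith
  refine ⟨(η / (η - 1) * C) ^ (b * τ), by positivity, ?_⟩
  intro f hf hP0 hP x hx hG hT
  have hR0 : 0 < ‖x‖ := norm_pos_iff.2 hx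
  have key := H f hf hP0 hP x hx hG hT
  have hPr : 0 < (radialIntegral d (γ * τ) τ f).toReal := ENNReal.toReal_pos hP0 hP
  set P := radialIntegral d (γ * τ) τ f
  set G := fracDensity s p α Λ (fun y : 𝔼 d => f ‖y‖) x
  set T := dilationAverage A τ f ‖x‖
  set R := ‖x‖
  have hg : 0 ≤ G.toReal := ENNReal.toReal_nonneg
  have ht : 0 ≤ T.toReal := ENNReal.toReal_nonneg
  have hsplit := rpow_le_of_le_add (abs_nonneg (f R)) (by positivity) (by positivity) hτ0 hb0 hη key
  rw [← Real.rpow_mul ht, one_div_mul_cancel hτ0.ne', Real.rpow_one] at hsplit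
  have hreal : R ^ (γ * τ) * |f R| ^ τ ≤ η ^ τ * (R ^ (γ * τ) * T.toReal) +
      (η / (η - 1) * C) ^ (b * τ) * P.toReal ^ ((1 - θ) * b) *
        (G.toReal ^ (θ * b * τ / p) * (R ^ (β * q) * |f R| ^ q) ^ ((1 - b) * τ / q)) := by
    have h1 := mul_le_mul_of_nonneg_left hsplit (by positivity : 0 ≤ R ^ (γ * τ))
    refine h1.trans (le_of_eq ?_)
    rw [← mul_assoc (η / (η - 1)), Real.mul_rpow (by positivity) (by positivity),
      Real.mul_rpow (x := (R ^ (s - s' - α) * G.toReal ^ (1 / p)) ^ θ) (by positivity)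
        (by positivity),
      Real.mul_rpow (x := R ^ (s - s' - α)) (by positivity) (by positivity),
      Real.mul_rpow (x := R ^ (-(((d : ℝ) - 1) / τ) - γ)) (by positivity) (by positivity),
      Real.mul_rpow (x := (R ^ (s - s' - α)) ^ θ) (by positivity) (by positivity),
      Real.mul_rpow (x := (R ^ (-(((d : ℝ) - 1) / τ) - γ)) ^ (1 - θ)) (by positivity)
        (by positivity),
      Real.mul_rpow (x := R ^ (β * q)) (by positivity) (by positivity)]
    simp only [← Real.rpow_mul hR0.le, ← Real.rpow_mul hg, ← Real.rpow_mul hPr.le,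
      ← Real.rpow_mul (abs_nonneg (f R))]
    have x1 : 1 / p * θ * (b * τ) = θ * b * τ / p := by ring
    have x2 : 1 / τ * (1 - θ) * (b * τ) = (1 - θ) * b := by field_simp
    have x3 : q * ((1 - b) * τ / q) = (1 - b) * τ := by field_simp
    -- `hexp` says precisely that all powers of |x| combine into the weight of the `β`-norm.
    have x4 : R ^ (β * q * ((1 - b) * τ / q)) = R ^ (γ * τ) *
        (R ^ ((s - s' - α) * θ * (b * τ)) *
          R ^ ((-(((d : ℝ) - 1) / τ) - γ) * (1 - θ) * (b * τ))) := by
      rw [← Real.rpow_add hR0, ← Real.rpow_add hR0]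
      congr 1
      have : β * q * ((1 - b) * τ / q) = β * (1 - b) * τ := by field_simp
      rw [this, ← hexp]
      ring
    rw [x1, x2, x3, x4]
    ring
  have hG' : G = ENNReal.ofReal G.toReal := (ENNReal.ofReal_toReal hG).symm
  have hT' : T = ENNReal.ofReal T.toReal := (ENNReal.ofReal_toReal hT).symm
  have hP' : P = ENNReal.ofReal P.toReal := (ENNReal.ofReal_toReal hP).symm
  have hw1 : 0 ≤ θ * b * τ / p := by positivity
  have hw2 : 0 ≤ (1 - b) * τ / q := by positivity
  have hw3 : 0 ≤ (1 - θ) * b := by positivity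
  rw [hG', hT', hP', Real.enorm_eq_ofReal_abs,
    ENNReal.ofReal_rpow_of_nonneg (abs_nonneg _) hτ0.le,
    ENNReal.ofReal_rpow_of_nonneg (abs_nonneg _) hq0.le,
    ENNReal.ofReal_rpow_of_nonneg hg hw1, ENNReal.ofReal_rpow_of_nonneg hPr.le hw3,
    ← ENNReal.ofReal_mul (by positivity), ← ENNReal.ofReal_mul (by positivity),
    ← ENNReal.ofReal_mul (by positivity), ← ENNReal.ofReal_mul (by positivity),
    ← ENNReal.ofReal_mul (by positivity),
    ENNReal.ofReal_rpow_of_nonneg (by positivity) hw2,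
    ← ENNReal.ofReal_mul (by positivity), ← ENNReal.ofReal_mul (by positivity),
    ← ENNReal.ofReal_add (by positivity) (by positivity)]
  exact ENNReal.ofReal_le_ofReal hreal

/-! ### Contraction, absorption and the inequality for finite left-hand side -/

theorem measurableSet_open_annulus {d : ℕ} (r R : ℝ) :
    MeasurableSet {z : 𝔼 d | r < ‖z‖ ∧ ‖z‖ < R} :=
  (measurableSet_lt measurable_const measurable_norm).inter
    (measurableSet_lt measurable_norm measurable_const)

theorem volume_open_annulus_ne_zero {d : ℕ} [Nontrivial (𝔼 d)] {r R : ℝ} (hr : 0 < r)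
    (hR : r < R) : volume {z : 𝔼 d | r < ‖z‖ ∧ ‖z‖ < R} ≠ 0 := by
  obtain ⟨z, hz⟩ := exists_norm_eq (𝔼 d) (by linarith : 0 ≤ (r + R) / 2)
  refine (IsOpen.measure_pos volume ?_ ⟨z, ?_⟩).ne'
  · exact (isOpen_lt continuous_const continuous_norm).inter
      (isOpen_lt continuous_norm continuous_const)
  · constructor <;> rw [hz] <;> linarith

/-- The annulus is taken inside the unit sphere for e < 0 and outside for e > 0. The intermediate
radius l keeps it away from the sphere, so that K < 1 uniformly. -/
theorem exists_contracting_annulus {d : ℕ} [Nontrivial (𝔼 d)] {Λ e : ℝ} (hΛ : 1 < Λ)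
    (he : e ≠ 0) :
    ∃ (A : Set (𝔼 d)) (K : ℝ), MeasurableSet A ∧ volume A ≠ 0 ∧
      (∀ z ∈ A, Λ⁻¹ ≤ ‖z‖ ∧ ‖z‖ ≤ Λ) ∧ 0 < K ∧ K < 1 ∧ ∀ z ∈ A, ‖z‖ ^ (-e) ≤ K := by
  obtain ⟨l, hl1, hlΛ⟩ := exists_between hΛ
  have hl0 : 0 < l := by linarith
  have hΛ0 : 0 < Λ := by linarith
  have hΛi : Λ⁻¹ < 1 := inv_lt_one_of_one_lt₀ hΛ
  have hli : l⁻¹ < 1 := inv_lt_one_of_one_lt₀ hl1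
  have hi : Λ⁻¹ < l⁻¹ := by gcongr
  have hΛi0 : 0 < Λ⁻¹ := by positivity
  rcases lt_or_gt_of_ne he with h | h
  · refine ⟨{z | Λ⁻¹ < ‖z‖ ∧ ‖z‖ < l⁻¹}, l⁻¹ ^ (-e), measurableSet_open_annulus _ _,
      volume_open_annulus_ne_zero hΛi0 hi, fun z hz => ⟨hz.1.le, ?_⟩, by positivity, ?_,
      fun z hz => ?_⟩
    · have := hz.2
      linarith
    · exact Real.rpow_lt_one (by positivity) hli (by linarith)
    · exact Real.rpow_le_rpow (norm_nonneg _) hz.2.le (by linarith)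
  · refine ⟨{z | l < ‖z‖ ∧ ‖z‖ < Λ}, l ^ (-e), measurableSet_open_annulus _ _,
      volume_open_annulus_ne_zero hl0 hlΛ, fun z hz => ⟨?_, hz.2.le⟩, by positivity, ?_,
      fun z hz => ?_⟩
    · have := hz.1
      linarith
    · exact Real.rpow_lt_one_of_one_lt_of_neg hl1 (by linarith)
    · exact Real.rpow_le_rpow_of_nonpos hl0 hz.1.le (by linarith)

theorem rpow_le_of_le_mul_add_mul_rpow {P D : ℝ≥0∞} {k e : ℝ} (hP0 : P ≠ 0) (hP : P ≠ ∞)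
    (hk0 : 0 ≤ k) (hk : k < 1) (h : P ≤ ENNReal.ofReal k * P + D * P ^ e) :
    P ^ (1 - e) ≤ ENNReal.ofReal (1 / (1 - k)) * D := by
  have hk1 : 0 < 1 - k := by linarith
  have h1 : P = ENNReal.ofReal k * P + ENNReal.ofReal (1 - k) * P := by
    rw [← add_mul, ← ENNReal.ofReal_add hk0 hk1.le]; simp
  have h2 : ENNReal.ofReal (1 - k) * P ≤ D * P ^ e := by
    refine (ENNReal.add_le_add_iff_left
      (ENNReal.mul_ne_top ENNReal.ofReal_ne_top hP : ENNReal.ofReal k * P ≠ ∞)).1 ?_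
    rw [← h1]; exact h
  have h3 : P ≤ ENNReal.ofReal (1 / (1 - k)) * (D * P ^ e) := by
    calc P = ENNReal.ofReal (1 / (1 - k)) * (ENNReal.ofReal (1 - k) * P) := by
          rw [← mul_assoc, ← ENNReal.ofReal_mul (by positivity), one_div_mul_cancel hk1.ne']
          simp
      _ ≤ _ := by gcongr
  calc P ^ (1 - e) = P * P ^ (-e) := by
        rw [sub_eq_add_neg, ENNReal.rpow_add _ _ hP0 hP, ENNReal.rpow_one]
    _ ≤ ENNReal.ofReal (1 / (1 - k)) * (D * P ^ e) * P ^ (-e) := by gcongr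
    _ = ENNReal.ofReal (1 / (1 - k)) * D * (P ^ e * P ^ (-e)) := by ring
    _ = _ := by rw [← ENNReal.rpow_add _ _ hP0 hP]; simp

theorem radialIntegral_eq_zero_of_eq_zero {d : ℕ} [Nontrivial (𝔼 d)] {κ κ' τ τ' : ℝ} (hτ : 0 < τ)
    (hτ' : 0 < τ') {f : ℝ → ℝ} (hf : Measurable f) (h : radialIntegral d κ τ f = 0) :
    radialIntegral d κ' τ' f = 0 := by
  rw [radialIntegral, lintegral_eq_zero_iff (by fun_prop)] at h
  rw [radialIntegral, lintegral_eq_zero_iff (by fun_prop)]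
  have h0 : ∀ᵐ x : 𝔼 d, x ≠ 0 := by simp [ae_iff]
  filter_upwards [h, h0] with x hx hx0
  have hR : 0 < ‖x‖ ^ κ := Real.rpow_pos_of_pos (norm_pos_iff.2 hx0) _
  have h1 : ‖f ‖x‖‖ₑ ^ τ = 0 := by
    rcases mul_eq_zero.1 hx with h | h
    · exact absurd h (by simpa using hR)
    · exact h
  have h2 : f ‖x‖ = 0 := by simpa [hτ, hτ.le, not_lt.2 hτ.le] using h1
  simp [hτ', h2]

/-- The interpolation inequality for radial functions with finite left-hand side. -/
theorem radial_interpolation_of_ne_top {d : ℕ} [Nontrivial (𝔼 d)] (hd : 1 ≤ d)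
    {s s' p q a α β γ Λ τ θ b : ℝ}
    (hs' : 0 < s') (hss' : s' ≤ s) (hp : 1 < p) (hq : 1 ≤ q) (hτ : 1 ≤ τ) (hΛ : 1 < Λ)
    (ha0 : 0 < a)
    (hθ : θ = 1 / (1 + s' * τ)) (hb0 : 0 < b) (hb1 : b ≤ 1)
    (hexp : γ + (s - s' - α) * θ * b + (-((d - 1) / τ) - γ) * (1 - θ) * b = β * (1 - b))
    (hw : θ * b * τ / p + (1 - b) * τ / q = 1)
    (hab : θ * b = a * (1 - (1 - θ) * b)) (hab' : 1 - b = (1 - a) * (1 - (1 - θ) * b))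
    (hE : γ * τ + d ≠ 0) :
    ∃ C : ℝ, 0 < C ∧ ∀ f : ℝ → ℝ, Measurable f → radialIntegral d (γ * τ) τ f ≠ ∞ →
      radialIntegral d (γ * τ) τ f ^ (1 / τ) ≤ ENNReal.ofReal C *
        ((∫⁻ x : 𝔼 d, fracDensity s p α Λ (fun y => f ‖y‖) x) ^ (1 / p)) ^ a *
        (radialIntegral d (β * q) q f ^ (1 / q)) ^ (1 - a) := by
  have hτ0 : 0 < τ := by linarith
  have hp0 : 0 < p := by linarith
  have hq0 : 0 < q := by linarith
  have hθ0 : 0 < θ := by rw [hθ]; positivity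
  have hθ1 : θ < 1 := by
    rw [hθ, div_lt_one (by positivity)]
    have := mul_pos hs' hτ0
    linarith
  have hb1' : 0 ≤ 1 - b := by linarith
  obtain ⟨A, K, hA, hA0, hAΛ, hK0, hK1, hAK⟩ := exists_contracting_annulus (d := d) hΛ hE
  have hAt : volume A ≠ ∞ := by
    refine ne_top_of_le_ne_top (measure_closedBall_lt_top (x := (0 : 𝔼 d)) (r := Λ)).ne
      (measure_mono fun z hz => ?_)
    simpa using (hAΛ z hz).2
  have hAne : ∀ z ∈ A, z ≠ 0 := by
    rintro z hz rfl
    have h1 := (hAΛ 0 hz).1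
    have h2 : 0 < Λ⁻¹ := by positivity
    rw [norm_zero] at h1
    linarith
  -- Chosen so that η^τ K = K^(1/2) < 1: the loss η^τ does not use up the contraction.
  set η := K ^ (-(1 / (2 * τ))) with hη
  have hη1 : 1 < η := Real.one_lt_rpow_of_pos_of_lt_one_of_neg hK0 hK1 (by
    have : 0 < 1 / (2 * τ) := by positivity
    linarith)
  have hηK : η ^ τ * K = K ^ (1 / 2 : ℝ) := by
    rw [hη, ← Real.rpow_mul hK0.le]
    nth_rewrite 2 [← Real.rpow_one K]
    rw [← Real.rpow_add hK0]
    congr 1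
    field_simp
    norm_num
  have hk0 : 0 ≤ η ^ τ * K := by positivity
  have hk1 : η ^ τ * K < 1 := by rw [hηK]; exact Real.rpow_lt_one hK0.le hK1 (by norm_num)
  obtain ⟨C, hC, H⟩ := weighted_rpow_le_dilation_add_product (β := β) hd hs' hss' hp hq hτ hΛ hθ
    hb0 hb1 hη1 hexp hA hA0 hAΛ
  set e := (1 - θ) * b with he
  have he1 : 0 < 1 - e := by
    rw [he]
    nlinarith
  set C' := 1 / (1 - η ^ τ * K) * C with hC'
  have hk1' : 0 < 1 - η ^ τ * K := by linarith
  have hC'0 : 0 < C' := by positivity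
  refine ⟨C' ^ (1 / ((1 - e) * τ)), by positivity, ?_⟩
  intro f hf hP
  set P := radialIntegral d (γ * τ) τ f with hPdef
  set Q := radialIntegral d (β * q) q f with hQdef
  set G := fracDensity s p α Λ (fun y : 𝔼 d => f ‖y‖) with hGdef
  have hGm : Measurable G := measurable_fracDensity s p α Λ (by fun_prop)
  rcases eq_or_ne P 0 with hP0 | hP0
  · rw [hP0, ENNReal.zero_rpow_of_pos (by positivity)]; exact zero_le
  have hQ0 : Q ≠ 0 := fun h => hP0 (radialIntegral_eq_zero_of_eq_zero hq0 hτ0 hf h)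
  have ha1 : 0 ≤ 1 - a := by
    by_contra hcon
    push Not at hcon
    nlinarith
  -- With an infinite seminorm the right-hand side is infinite, because f is not almost everywhere
  -- zero and so the product cannot be ∞ · 0.
  rcases eq_or_ne (∫⁻ x, G x) ∞ with hG | hG
  · rw [hG, ENNReal.top_rpow_of_pos (by positivity), ENNReal.top_rpow_of_pos ha0,
      ENNReal.mul_top (by simp; positivity), ENNReal.top_mul]
    · exact le_top
    · intro h0
      rcases ENNReal.rpow_eq_zero_iff.1 h0 with ⟨h, -⟩ | ⟨-, h⟩
      · rcases ENNReal.rpow_eq_zero_iff.1 h with ⟨h, -⟩ | ⟨-, h⟩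
        · exact hQ0 h
        · have : 0 < 1 / q := by positivity
          linarith
      · linarith
  have hdil : ∫⁻ x : 𝔼 d, ENNReal.ofReal (‖x‖ ^ (γ * τ)) * dilationAverage A τ f ‖x‖ ≤
      ENNReal.ofReal K * P := by
    have h1 := lintegral_dilation_average_le (d := d) (φ := fun t => ‖f t‖ₑ ^ τ) (by fun_prop)
      hA hAne hAK
    calc ∫⁻ x : 𝔼 d, ENNReal.ofReal (‖x‖ ^ (γ * τ)) * dilationAverage A τ f ‖x‖
        = ∫⁻ x : 𝔼 d, (volume A)⁻¹ *
            (ENNReal.ofReal (‖x‖ ^ (γ * τ)) * ∫⁻ z in A, ‖f (‖x‖ * ‖z‖)‖ₑ ^ τ) := by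
          refine lintegral_congr fun x => ?_
          rw [dilationAverage]; ring
      _ ≤ (volume A)⁻¹ * (ENNReal.ofReal K * volume A * P) := by
          rw [lintegral_const_mul' _ _ (ENNReal.inv_ne_top.2 hA0)]
          gcongr
          exact h1
      _ = ((volume A)⁻¹ * volume A) * (ENNReal.ofReal K * P) := by ring
      _ = _ := by rw [ENNReal.inv_mul_cancel hA0 hAt, one_mul]
  have hdm : Measurable (fun x : 𝔼 d =>
      ENNReal.ofReal (‖x‖ ^ (γ * τ)) * dilationAverage A τ f ‖x‖) := by
    unfold dilationAverage
    have : Measurable (fun x : 𝔼 d => ∫⁻ z in A, ‖f (‖x‖ * ‖z‖)‖ₑ ^ τ) :=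
      Measurable.lintegral_prod_right' (ν := volume.restrict A)
        (f := fun w : (𝔼 d) × (𝔼 d) => ‖f (‖w.1‖ * ‖w.2‖)‖ₑ ^ τ) (by fun_prop)
    fun_prop
  have hPe : P ^ e ≠ ∞ := by
    rw [Ne, ENNReal.rpow_eq_top_iff]; simp [hP0, hP]
  set Y := (∫⁻ x, G x) ^ (θ * b * τ / p) * Q ^ ((1 - b) * τ / q) with hY
  have h_int : P ≤ ENNReal.ofReal (η ^ τ * K) * P + (ENNReal.ofReal C * Y) * P ^ e := by
    have h0 : ∀ᵐ x : 𝔼 d, x ≠ 0 := by simp [ae_iff]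
    have h1 : ∀ᵐ x : 𝔼 d, G x < ∞ := ae_lt_top hGm hG
    have h2 := ae_lt_top hdm
      (ne_top_of_le_ne_top (ENNReal.mul_ne_top ENNReal.ofReal_ne_top hP) hdil)
    calc P ≤ ∫⁻ x : 𝔼 d, (ENNReal.ofReal (η ^ τ) *
          (ENNReal.ofReal (‖x‖ ^ (γ * τ)) * dilationAverage A τ f ‖x‖) +
          ENNReal.ofReal C * P ^ e * (G x ^ (θ * b * τ / p) *
            (ENNReal.ofReal (‖x‖ ^ (β * q)) * ‖f ‖x‖‖ₑ ^ q) ^ ((1 - b) * τ / q))) := by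
          refine lintegral_mono_ae ?_
          filter_upwards [h0, h1, h2] with x hx0 hx1 hx2
          refine H f hf hP0 hP x hx0 hx1.ne fun hT => ?_
          have hR : 0 < ‖x‖ ^ (γ * τ) := Real.rpow_pos_of_pos (norm_pos_iff.2 hx0) _
          rw [hT, ENNReal.mul_top (by simpa using hR)] at hx2
          exact lt_irrefl _ hx2
      _ = ENNReal.ofReal (η ^ τ) *
          (∫⁻ x : 𝔼 d, ENNReal.ofReal (‖x‖ ^ (γ * τ)) * dilationAverage A τ f ‖x‖) +
          ENNReal.ofReal C * P ^ e * ∫⁻ x : 𝔼 d, (G x ^ (θ * b * τ / p) *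
            (ENNReal.ofReal (‖x‖ ^ (β * q)) * ‖f ‖x‖‖ₑ ^ q) ^ ((1 - b) * τ / q)) := by
          rw [lintegral_add_left (hdm.const_mul _), lintegral_const_mul _ hdm,
            lintegral_const_mul' _ _ (ENNReal.mul_ne_top ENNReal.ofReal_ne_top hPe)]
      _ ≤ ENNReal.ofReal (η ^ τ) * (ENNReal.ofReal K * P) + ENNReal.ofReal C * P ^ e * Y := by
          gcongr
          -- Hölder's inequality; `hw` states that the two exponents sum to 1.
          exact ENNReal.lintegral_mul_norm_pow_le hGm.aemeasurable (by fun_prop)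
            (by positivity) (by positivity) hw
      _ = _ := by rw [ENNReal.ofReal_mul (by positivity)]; ring
  have habs := rpow_le_of_le_mul_add_mul_rpow hP0 hP hk0 hk1 h_int
  have hz : 0 ≤ 1 / ((1 - e) * τ) := by positivity
  calc P ^ (1 / τ) = (P ^ (1 - e)) ^ (1 / ((1 - e) * τ)) := by
        rw [← ENNReal.rpow_mul]; congr 1; field_simp
    _ ≤ (ENNReal.ofReal C' * Y) ^ (1 / ((1 - e) * τ)) := by
        refine ENNReal.rpow_le_rpow ?_ hz
        rw [hC', ENNReal.ofReal_mul (by positivity), mul_assoc]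
        exact habs
    _ = _ := by
        rw [hY, ← mul_assoc, ENNReal.mul_rpow_of_nonneg _ _ hz, ENNReal.mul_rpow_of_nonneg _ _ hz,
          ENNReal.ofReal_rpow_of_nonneg hC'0.le hz, ← ENNReal.rpow_mul, ← ENNReal.rpow_mul,
          ← ENNReal.rpow_mul, ← ENNReal.rpow_mul]
        congr 2
        · rw [hab]; congr 1; field_simp
        · rw [hab']; field_simp

/-! ### From u to its profile; truncation -/

theorem weightedNorm_eq_radialIntegral {d : ℕ} {γ τ : ℝ} (hτ : 1 ≤ τ) {u : (𝔼 d) → ℝ} {f : ℝ → ℝ}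
    (huf : ∀ᵐ x, u x = f ‖x‖) :
    weightedNorm γ τ u = radialIntegral d (γ * τ) τ f ^ (1 / τ) := by
  have hτ0 : 0 < τ := by linarith
  rw [weightedNorm, eLpNorm_eq_lintegral_rpow_enorm_toReal (by simpa using hτ0)
    ENNReal.ofReal_ne_top, ENNReal.toReal_ofReal hτ0.le, radialIntegral]
  congr 1
  refine lintegral_congr_ae ?_
  filter_upwards [huf] with x hx
  rw [hx, enorm_mul, ENNReal.mul_rpow_of_nonneg _ _ hτ0.le,
    Real.enorm_of_nonneg (by positivity), ENNReal.ofReal_rpow_of_nonneg (by positivity) hτ0.le,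
    ← Real.rpow_mul (norm_nonneg _)]

theorem fracSeminorm_congr_ae {d : ℕ} (s p α Λ : ℝ) {u v : (𝔼 d) → ℝ}
    (huv : ∀ᵐ x, u x = v x) : fracSeminorm s p α Λ u = fracSeminorm s p α Λ v := by
  unfold fracSeminorm
  congr 1
  refine lintegral_congr_ae ?_
  filter_upwards [huv] with y hy
  refine lintegral_congr_ae ?_
  filter_upwards [huv] with x hx
  rw [hx, hy]

/-- Truncation of a real function at height `n`. -/
noncomputable def truncateAt (n : ℕ) (f : ℝ → ℝ) (t : ℝ) : ℝ := max (-n) (min (f t) n)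

theorem measurable_truncateAt (n : ℕ) {f : ℝ → ℝ} (hf : Measurable f) :
    Measurable (truncateAt n f) := by
  unfold truncateAt
  fun_prop

theorem abs_truncateAt_le (n : ℕ) (f : ℝ → ℝ) (t : ℝ) : |truncateAt n f t| ≤ n := by
  have hn : (0 : ℝ) ≤ n := n.cast_nonneg
  rw [truncateAt, abs_le]
  exact ⟨le_max_left _ _, max_le (by linarith) (min_le_right _ _)⟩

theorem abs_truncateAt_sub_le (n : ℕ) (f : ℝ → ℝ) (t r : ℝ) :
    |truncateAt n f t - truncateAt n f r| ≤ |f t - f r| := by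
  refine (abs_max_sub_max_le_max _ _ _ _).trans ?_
  rw [sub_self, abs_zero]
  refine max_le (abs_nonneg _) ((abs_min_sub_min_le_max _ _ _ _).trans ?_)
  simp

theorem truncateAt_of_eq_zero (n : ℕ) {f : ℝ → ℝ} {t : ℝ} (h : f t = 0) :
    truncateAt n f t = 0 := by
  simp [truncateAt, h]

theorem abs_truncateAt_le_abs (n : ℕ) (f : ℝ → ℝ) (t : ℝ) : |truncateAt n f t| ≤ |f t| := by
  have hn : (0 : ℝ) ≤ n := n.cast_nonneg
  rw [truncateAt, abs_le]
  constructor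
  · refine le_max_of_le_right (le_min (neg_abs_le _) ?_)
    linarith [abs_nonneg (f t)]
  · refine max_le ?_ ((min_le_left _ _).trans (le_abs_self _))
    linarith [abs_nonneg (f t)]

theorem truncateAt_eq_of_le {n : ℕ} {f : ℝ → ℝ} {t : ℝ} (h : |f t| ≤ n) :
    truncateAt n f t = f t := by
  rw [abs_le] at h
  rw [truncateAt, min_eq_left h.2, max_eq_right h.1]

theorem radialIntegral_truncateAt_le (d n : ℕ) (κ : ℝ) {τ : ℝ} (hτ : 0 ≤ τ) (f : ℝ → ℝ) :
    radialIntegral d κ τ (truncateAt n f) ≤ radialIntegral d κ τ f := by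
  unfold radialIntegral
  gcongr with x
  exact enorm_le_iff_norm_le.2 (abs_truncateAt_le_abs n f _)

theorem chiCut_nonneg (Λ r₁ r₂ : ℝ) : 0 ≤ chiCut Λ r₁ r₂ := by
  unfold chiCut
  split_ifs <;> norm_num

theorem fracDensity_truncateAt_le {d : ℕ} (n : ℕ) (s α Λ : ℝ) {p : ℝ} (hp : 0 ≤ p) (f : ℝ → ℝ)
    (x : 𝔼 d) : fracDensity s p α Λ (fun y : 𝔼 d => truncateAt n f ‖y‖) x ≤
      fracDensity s p α Λ (fun y : 𝔼 d => f ‖y‖) x := by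
  refine lintegral_mono fun y => ENNReal.ofReal_le_ofReal ?_
  refine mul_le_mul_of_nonneg_right ?_ (chiCut_nonneg _ _ _)
  have := Real.rpow_le_rpow (abs_nonneg _) (abs_truncateAt_sub_le n f ‖x‖ ‖y‖) hp
  gcongr

/-- Fatou's lemma: at each point the truncations are eventually equal to f. -/
theorem radialIntegral_le_of_forall_truncateAt {d : ℕ} {κ τ : ℝ} {f : ℝ → ℝ} (hf : Measurable f)
    {B : ℝ≥0∞} (h : ∀ n, radialIntegral d κ τ (truncateAt n f) ≤ B) :
    radialIntegral d κ τ f ≤ B := by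
  have hlim : ∀ x : 𝔼 d, Filter.liminf
      (fun n : ℕ => ENNReal.ofReal (‖x‖ ^ κ) * ‖truncateAt n f ‖x‖‖ₑ ^ τ) Filter.atTop =
      ENNReal.ofReal (‖x‖ ^ κ) * ‖f ‖x‖‖ₑ ^ τ := by
    intro x
    refine Filter.Tendsto.liminf_eq (tendsto_const_nhds.congr' ?_)
    obtain ⟨N, hN⟩ := exists_nat_ge |f ‖x‖|
    filter_upwards [Filter.eventually_ge_atTop N] with n hn
    rw [truncateAt_eq_of_le (hN.trans (by exact_mod_cast hn))]
  calc radialIntegral d κ τ f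
      = ∫⁻ x : 𝔼 d, Filter.liminf
          (fun n : ℕ => ENNReal.ofReal (‖x‖ ^ κ) * ‖truncateAt n f ‖x‖‖ₑ ^ τ) Filter.atTop := by
        simp only [hlim]; rfl
    _ ≤ Filter.liminf (fun n => radialIntegral d κ τ (truncateAt n f)) Filter.atTop :=
        lintegral_liminf_le fun n => by
          have := measurable_truncateAt n hf
          fun_prop
    _ ≤ B := Filter.liminf_le_of_frequently_le' (Filter.Frequently.of_forall h)

/-- In polar coordinates the weight becomes t^(κ+d-1), so finiteness depends only on the set J of
radii. -/
theorem radialIntegral_ne_top_of_bounded {d : ℕ} [Nontrivial (𝔼 d)] (hd : 1 ≤ d) {κ τ M : ℝ}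
    (hτ : 0 < τ) {J : Set ℝ} (hJ : MeasurableSet J)
    (h_int : IntegrableOn (fun t : ℝ => t ^ (κ + d - 1)) (J ∩ Ioi 0)) {f : ℝ → ℝ}
    (hM : ∀ t, |f t| ≤ M) (hz : ∀ᵐ x : 𝔼 d, ‖x‖ ∉ J → f ‖x‖ = 0) :
    radialIntegral d κ τ f ≠ ∞ := by
  have h1 : Integrable (fun x : 𝔼 d => J.indicator (fun t => t ^ κ) ‖x‖) volume := by
    rw [integrable_fun_norm_addHaar, finrank_euclideanSpace_fin]
    have h2 : IntegrableOn (J.indicator fun t : ℝ => t ^ (κ + d - 1)) (Ioi 0) := by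
      rw [IntegrableOn, integrable_indicator_iff hJ, IntegrableOn, Measure.restrict_restrict hJ]
      exact h_int
    refine h2.congr_fun (fun t ht => ?_) measurableSet_Ioi
    have ht0 : (0 : ℝ) < t := ht
    by_cases htJ : t ∈ J
    · simp only [indicator_of_mem htJ, smul_eq_mul]
      rw [← Real.rpow_natCast, ← Real.rpow_add ht0, Nat.cast_sub hd]
      congr 1
      push_cast
      ring
    · simp [indicator_of_notMem htJ]
  have hM0 : 0 ≤ M := (abs_nonneg _).trans (hM 0)
  have h3 := (h1.const_mul (M ^ τ)).lintegral_lt_top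
  refine ne_top_of_le_ne_top h3.ne (lintegral_mono_ae ?_)
  filter_upwards [hz] with x hx
  by_cases hxJ : ‖x‖ ∈ J
  · rw [indicator_of_mem hxJ, mul_comm, ENNReal.ofReal_mul (by positivity),
      Real.enorm_eq_ofReal_abs, ENNReal.ofReal_rpow_of_nonneg (abs_nonneg _) hτ.le]
    gcongr
    exact hM _
  · simp [hx hxJ, hτ]

/-- The interpolation inequality for a radial function all of whose truncations have finite
weighted norm. -/
theorem weightedNorm_le_of_truncateAt {d : ℕ} [Nontrivial (𝔼 d)] {s p q a α β γ Λ τ C : ℝ}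
    (hp : 1 < p) (hq : 1 ≤ q) (hτ : 1 ≤ τ) (ha0 : 0 < a) (ha1 : a ≤ 1)
    (H : ∀ f : ℝ → ℝ, Measurable f → radialIntegral d (γ * τ) τ f ≠ ∞ →
      radialIntegral d (γ * τ) τ f ^ (1 / τ) ≤ ENNReal.ofReal C *
        ((∫⁻ x : 𝔼 d, fracDensity s p α Λ (fun y => f ‖y‖) x) ^ (1 / p)) ^ a *
        (radialIntegral d (β * q) q f ^ (1 / q)) ^ (1 - a))
    {u : (𝔼 d) → ℝ} {f : ℝ → ℝ} (hf : Measurable f) (huf : ∀ᵐ x, u x = f ‖x‖)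
    (hfin : ∀ n, radialIntegral d (γ * τ) τ (truncateAt n f) ≠ ∞) :
    weightedNorm γ τ u ≤
      ENNReal.ofReal C * fracSeminorm s p α Λ u ^ a * weightedNorm β q u ^ (1 - a) := by
  have hτ0 : 0 < τ := by linarith
  have hp0 : 0 < p := by linarith
  have hq0 : 0 < q := by linarith
  have h1a : 0 ≤ 1 - a := by linarith
  rw [weightedNorm_eq_radialIntegral hτ huf, weightedNorm_eq_radialIntegral hq huf,
    fracSeminorm_congr_ae s p α Λ huf,
    fracSeminorm_eq_lintegral_fracDensity s p α Λ (g := fun y : 𝔼 d => f ‖y‖) (by fun_prop),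
    one_div τ, ENNReal.rpow_inv_le_iff hτ0]
  refine radialIntegral_le_of_forall_truncateAt hf fun n => ?_
  rw [← ENNReal.rpow_inv_le_iff hτ0, ← one_div]
  refine (H _ (measurable_truncateAt n hf) (hfin n)).trans ?_
  gcongr
  · exact fracDensity_truncateAt_le n s α Λ hp0.le f _
  · exact radialIntegral_truncateAt_le d n _ hq0.le f

/-! ### Choice of exponents and conclusion -/

theorem aemeasurable_of_locallyIntegrableOn_compl_zero {d : ℕ} [Nontrivial (𝔼 d)] {u : (𝔼 d) → ℝ}
    (hu : LocallyIntegrableOn u {0}ᶜ volume) : AEMeasurable u := by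
  have := hu.aestronglyMeasurable
  rw [restrict_compl_singleton] at this
  exact this.aemeasurable

theorem mainTheorem1 (d : ℕ) (hd : 2 ≤ d)
    (s p q τ a α β γ σ Λ : ℝ)
    (hs0 : 0 < s) (hs1 : s < 1) (hp : 1 < p) (hq : 1 ≤ q) (hτ : 1 ≤ τ)
    (ha0 : 0 < a) (ha1 : a ≤ 1) (hΛ : 1 < Λ)
    (hσ : γ = a * σ + (1 - a) * β)
    (hbalance : 1 / τ + γ / d = a * (1 / p + (α - s) / d) + (1 - a) * (1 / q + β / d))
    (hlow : -((d : ℝ) - 1) * s ≤ α - σ) (hneg : α - σ < 0) :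
    ∃ C : ℝ, 0 < C ∧
      (0 < 1 / τ + γ / d →
        ∀ u : EuclideanSpace ℝ (Fin d) → ℝ,
          LocallyIntegrableOn u {0}ᶜ volume → IsRadial u → HasCompactEssSupport u →
          weightedNorm γ τ u ≤
            ENNReal.ofReal C * fracSeminorm s p α Λ u ^ a * weightedNorm β q u ^ (1 - a)) ∧
      (1 / τ + γ / d < 0 →
        ∀ u : EuclideanSpace ℝ (Fin d) → ℝ,
          LocallyIntegrableOn u {0}ᶜ volume → IsRadial u → VanishesNearZero u →
          weightedNorm γ τ u ≤
            ENNReal.ofReal C * fracSeminorm s p α Λ u ^ a * weightedNorm β q u ^ (1 - a)) := by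
  -- In this borderline case neither (i) nor (ii) applies; otherwise a contracting annulus exists.
  by_cases hE : γ * τ + d = 0
  · have hz : 1 / τ + γ / d = 0 := by
      have hτ0 : 0 < τ := by linarith
      have hd0 : (0 : ℝ) < d := by exact_mod_cast (by omega : 0 < d)
      field_simp
      linarith
    exact ⟨1, one_pos, fun h => absurd hz h.ne', fun h => absurd hz h.ne⟩
  have : Nontrivial (EuclideanSpace ℝ (Fin d)) :=
    Module.nontrivial_of_finrank_pos (R := ℝ) (by rw [finrank_euclideanSpace_fin]; omega)
  have hτ0 : 0 < τ := by linarith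
  have hp0 : 0 < p := by linarith
  have hq0 : 0 < q := by linarith
  have hd0 : (0 : ℝ) < d := by exact_mod_cast (by omega : 0 < d)
  -- The smoothness forced by homogeneity: the balance law becomes a/p + (1-a)/q = 1/τ + a s'. The
  -- lower bound on α - σ is equivalent to s' ≤ s, and α < σ gives s' > 0.
  set s' := (s + σ - α) / d with hs'
  have hs'0 : 0 < s' := div_pos (by linarith) hd0
  have hss' : s' ≤ s := by rw [hs', div_le_iff₀ hd0]; linarith
  have hds' : d * s' = s + σ - α := by rw [hs']; field_simp
  set m := s' * τ with hm
  have hm0 : 0 < m := by positivity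
  have ham : 0 < 1 + a * m := by positivity
  have hbal : τ * (a / p + (1 - a) / q) = 1 + a * m := by
    have h1 : a / p + (1 - a) / q = 1 / τ + a * s' := by
      rw [hs']
      have h2 := hbalance
      rw [hσ] at h2
      have h3 : 1 / τ + a * ((s + σ - α) / d) = (1 / τ + (a * σ + (1 - a) * β) / d) -
        a * ((α - s) / d) - (1 - a) * (β / d) := by field_simp; ring
      rw [h3, h2]; ring
    rw [h1, hm]; field_simp
  have e1 : 1 / (1 + m) * (a * (1 + m) / (1 + a * m)) = a / (1 + a * m) := by field_simp
  have e2 : (1 - 1 / (1 + m)) * (a * (1 + m) / (1 + a * m)) = a * m / (1 + a * m) := by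
    field_simp; ring
  have e3 : 1 - a * (1 + m) / (1 + a * m) = (1 - a) / (1 + a * m) := by field_simp; ring
  have e4 : 1 - a * m / (1 + a * m) = 1 / (1 + a * m) := by field_simp; ring
  -- The value of b is dictated by requiring that, after P^e is absorbed, the exponents of the two
  -- norms be a and 1 - a; b ≤ 1 then amounts to a ≤ 1.
  obtain ⟨C, hC, H⟩ := radial_interpolation_of_ne_top (d := d) (by omega) (s := s) (s' := s')
    (a := a) (α := α) (β := β) (γ := γ) (θ := 1 / (1 + m)) (b := a * (1 + m) / (1 + a * m))
    hs'0 hss' hp hq hτ hΛ ha0 rfl (by positivity)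
    (by rw [div_le_one ham]; nlinarith)
    (by
      rw [mul_assoc, mul_assoc, e1, e2, e3]
      have h1 : ((d : ℝ) - 1) / τ * m = (d - 1) * s' := by rw [hm]; field_simp
      have h2 : γ + (s - s' - α) * (a / (1 + a * m)) +
          (-(((d : ℝ) - 1) / τ) - γ) * (a * m / (1 + a * m)) =
          (γ + a * (s - s' - α) - a * (((d : ℝ) - 1) / τ * m)) / (1 + a * m) := by
        field_simp; ring
      have h3 : γ + a * (s - s' - α) - a * (((d : ℝ) - 1) * s') = β * (1 - a) := by
        clear_value s'
        linear_combination (-a) * hds' + hσ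
      rw [h2, h1, h3, ← mul_div_assoc])
    (by
      rw [e1, e3, show a / (1 + a * m) * τ / p + (1 - a) / (1 + a * m) * τ / q =
        τ * (a / p + (1 - a) / q) / (1 + a * m) by field_simp, hbal, div_self ham.ne'])
    (by rw [e1, e2, e4]; ring) (by rw [e2, e3, e4]; ring) hE
  have hsign : (1 / τ + γ / d) * (τ * d) = γ * τ + d := by field_simp; ring
  refine ⟨C, hC, fun hpos u hu hrad hsupp => ?_, fun hneg u hu hrad hvan => ?_⟩
  · obtain ⟨f, hf, huf⟩ := exists_measurable_radial_representative
      (aemeasurable_of_locallyIntegrableOn_compl_zero hu) hrad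
    refine weightedNorm_le_of_truncateAt hp hq hτ ha0 ha1 H hf huf fun n => ?_
    obtain ⟨K, hK, hKu⟩ := hsupp
    obtain ⟨ρ, hρ⟩ := hK.isBounded.subset_closedBall 0
    have hE0 : 0 < γ * τ + d := by rw [← hsign]; positivity
    -- The maximum with 0 covers a negative ρ, possible when K is empty. Integrability at 0 is the
    -- condition γτ + d > 0.
    refine radialIntegral_ne_top_of_bounded (by omega) hτ0 (J := Iic (max ρ 0)) measurableSet_Iic
      ?_ (abs_truncateAt_le n f) ?_
    · have h := intervalIntegral.intervalIntegrable_rpow' (a := 0) (b := max ρ 0)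
        (r := γ * τ + d - 1) (by linarith)
      rw [intervalIntegrable_iff_integrableOn_Ioc_of_le (le_max_right _ _)] at h
      rwa [Iic_inter_Ioi]
    · filter_upwards [huf, hKu] with x h1 h2 h3
      refine truncateAt_of_eq_zero n ?_
      rw [← h1]
      refine h2 fun hxK => h3 ?_
      have : ‖x‖ ≤ ρ := by simpa using hρ hxK
      exact this.trans (le_max_left _ _)
  · obtain ⟨f, hf, huf⟩ := exists_measurable_radial_representative
      (aemeasurable_of_locallyIntegrableOn_compl_zero hu) hrad
    refine weightedNorm_le_of_truncateAt hp hq hτ ha0 ha1 H hf huf fun n => ?_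
    obtain ⟨r, hr, hru⟩ := hvan
    have hE0 : γ * τ + d < 0 := by
      rw [← hsign]; exact mul_neg_of_neg_of_pos hneg (by positivity)
    refine radialIntegral_ne_top_of_bounded (by omega) hτ0 (J := Ici r) measurableSet_Ici
      ?_ (abs_truncateAt_le n f) ?_
    -- Integrability at infinity is the condition γτ + d < 0; r/2 is used so that the closed
    -- half-line from r lies in an open one.
    · refine (integrableOn_Ioi_rpow_of_lt (a := γ * τ + d - 1) (by linarith) (half_pos hr)).mono_set
        fun t ht => ?_
      have h1 : r ≤ t := ht.1
      exact lt_of_lt_of_le (half_lt_self hr) h1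
    · filter_upwards [huf, hru] with x h1 h2 h3
      refine truncateAt_of_eq_zero n ?_
      rw [← h1]
      exact h2 (not_le.1 h3)
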